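/- Let $n\ge 2$, let $\Omega\subseteq\mathbb{R}^n$ be open and let $\nu,C_1,\dots,C_{n-2},H=C_{n-1}\in C^\infty(\Omega,\mathbb{R})$. Define a Poisson bracket on $C^\infty(\Omega,\mathbb R)$ by $\{f,g\}\,dx_1\wedge\dots\wedge dx_n=\nu\, dC_1\wedge\dots\wedge dC_{n-2}\wedge df\wedge dg$; for $h\in C^\infty(\Omega,\mathbb R)$ let $X_h=(\{x_1,h\},\dots,\{x_n,h\})$ be its Hamiltonian vector field, and let $X=X_H$. The symplectic leaf $\Sigma$ through a point $\bar x_e\in\Omega$ is the set of points of $\Omega$ that can be joined with $\bar x_e$ by finitely many pieces of integral curves of Hamiltonian vector fields $X_h$. Let $\bar x_e\in\Omega$ be a non-degenerate regular equilibrium: $\nu(\bar x_e)\ne0$, the vectors $\nabla C_1(\bar x_e),\dots,\nabla C_{n-2}(\bar x_e)$ are linearly independent, $\nabla C_1(\bar x_e),\dots,\nabla C_{n-2}(\bar x_e),\nabla H(\bar x_e)$ are linearly dependent, and, with $\lambda\in\mathbb{R}^{n-2}$ the unique vector for which $F=H+\lambda_1C_1+\dots+\lambda_{n-2}C_{n-2}$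 satisfies $\nabla F(\bar x_e)=0$, the Hessian operator $A=D(\nabla F)(\bar x_e)$ is invertible. Put $$\mathcal I_X(\bar x_e)=\nu(\bar x_e)^2\,\det(A)\,\det\big(\langle A^{-1}\nabla C_i(\bar x_e),\nabla C_j(\bar x_e)\rangle\big)_{1\le i,j\le n-2}.$$ Then $X(\bar x_e)=0$ and the following hold. (Neighbourhoods in $\Sigma$ are taken in the subspace topology.) (a) The linearization of $X|_\Sigma$ at $\bar x_e$, that is, the linear map $T_{\bar x_e}\Sigma\to T_{\bar x_e}\Sigma$, $v\mapsto\frac{d}{dt}\big|_{t=0}\big(DF_t(\bar x_e)v\big)$ with $F_t$ the flow of $X|_\Sigma$, has characteristic polynomial $\mu^2+\mathcal I_X(\bar x_e)$. (b) If $\mathcal I_X(\bar x_e)<0$, then $\bar x_e$ is an unstable (i.e. not Lyapunov stable) equilibrium of $X|_\Sigma$. (c) If $\mathcal I_X(\bar x_e)>0$, then $\bar x_e$ is a Lyapunov stable equilibrium of $X|_\Sigma$: for every neighbourhood $U$ of $\bar x_e$ in $\Sigma$ there is a neighbourhood $V\subseteq U$ of $\bar x_e$ in $\Sigma$ such that $F_t(x)$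 is defined and lies in $U$ for all $x\in V$ and $t\ge0$. (d) If $\mathcal I_X(\bar x_e)>0$, then there are $\varepsilon_0>0$ and a one-parameter family $\{\gamma_\varepsilon\}_{0<\varepsilon\le\varepsilon_0}$ of pairwise disjoint periodic orbits of $X|_\Sigma$, with parametrizations by solutions that are jointly continuous in $\varepsilon$ and time, such that, as $\varepsilon\to0$, the $\gamma_\varepsilon$ shrink to $\bar x_e$ (every neighbourhood of $\bar x_e$ contains all $\gamma_\varepsilon$ with $\varepsilon$ small enough) and their minimal periods $T_\varepsilon$ tend to $2\pi/\sqrt{\mathcal I_X(\bar x_e)}$. Moreover, $\{\bar x_e\}\cup\bigcup_{0<\varepsilon<\varepsilon_0}\gamma_\varepsilon$ is the connected component of $\Sigma\setminus\gamma_{\varepsilon_0}$ that contains $\bar x_e$. -/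

import Mathlib

open scoped ContDiff Topology

noncomputable section

/-- The phase space `ℝⁿ` with `n = k + 2`, with its canonical inner product. -/
abbrev PhaseSpace (k : ℕ) : Type := EuclideanSpace ℝ (Fin (k + 2))

/-! ### Integral curves, stability and periodic orbits of `X|_M`, for an invariant set `M` -/

/-- `FlowsTo X M t y z`: the flow of `X|_M` is defined at `y` up to the time `t ≥ 0`, and
`F_t(y) = z`. -/
def FlowsTo {k : ℕ} (X : PhaseSpace k → PhaseSpace k) (M : Set (PhaseSpace k))
    (t : ℝ) (y z : PhaseSpace k) : Prop :=
  ∃ c : ℝ → PhaseSpace k, c 0 = y ∧ c t = z ∧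
    ∀ s ∈ Set.Icc 0 t, c s ∈ M ∧ HasDerivWithinAt c (X (c s)) (Set.Icc 0 t) s

/-- Lyapunov stability of the point `x` for `X|_M`. The neighbourhoods of `x` in `M` are the traces
on `M` of open sets; "`F_t(y) ∈ U`" includes that `F_t(y)` is defined. -/
def LyapunovStableOn {k : ℕ} (X : PhaseSpace k → PhaseSpace k) (M : Set (PhaseSpace k))
    (x : PhaseSpace k) : Prop :=
  ∀ U : Set (PhaseSpace k), IsOpen U → x ∈ U →
    ∃ V : Set (PhaseSpace k), IsOpen V ∧ x ∈ V ∧ V ⊆ U ∧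
      ∀ y ∈ V ∩ M, ∀ t : ℝ, 0 ≤ t → ∃ z ∈ U, FlowsTo X M t y z

/-- An equilibrium is unstable if it is not Lyapunov stable. -/
def UnstableOn {k : ℕ} (X : PhaseSpace k → PhaseSpace k) (M : Set (PhaseSpace k))
    (x : PhaseSpace k) : Prop :=
  ¬ LyapunovStableOn X M x

/-- `c` is a (non-constant) periodic solution of `X|_M` with minimal period `T`. The periodic orbit
itself is `Set.range c`. -/
structure IsPeriodicSolutionOn {k : ℕ} (X : PhaseSpace k → PhaseSpace k) (M : Set (PhaseSpace k))
    (c : ℝ → PhaseSpace k) (T : ℝ) : Prop where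
  mem : ∀ t, c t ∈ M
  deriv : ∀ t, HasDerivAt c (X (c t)) t
  period_pos : 0 < T
  periodic : Function.Periodic c T
  minimal : ∀ s, 0 < s → s < T → c s ≠ c 0

/-- The tangent space at `x` of a submanifold `M`: the space of velocities at `0` of curves in `M`
through `x` (for a submanifold these velocities already form a linear subspace). -/
def tangentSpaceOf {k : ℕ} (M : Set (PhaseSpace k)) (x : PhaseSpace k) :
    Submodule ℝ (PhaseSpace k) :=
  Submodule.span ℝ {v | ∃ c : ℝ → PhaseSpace k,
    c 0 = x ∧ (∀ᶠ s in 𝓝 (0 : ℝ), c s ∈ M) ∧ HasDerivAt c v 0}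

/-- `L` is the linearization of `X|_M` at the equilibrium `x`, where `M` is a submanifold to which
`X` is tangent: `L v = d/dt|_{t=0} (D F_t(x) v)`. Here `F` is the flow of `X|_M` for small times near
`x` (unique, as solutions are), and `D t = D F_t(x)`, which maps the tangent space at `x` to itself
since `F_t(x) = x`, is the differential of `F_t : M → M`, given by its action on velocities. -/
def IsLinearizationOn {k : ℕ} (X : PhaseSpace k → PhaseSpace k) (M : Set (PhaseSpace k))
    (x : PhaseSpace k) (L : tangentSpaceOf M x →ₗ[ℝ] tangentSpaceOf M x) : Prop :=
  ∃ (δ : ℝ) (W : Set (PhaseSpace k)) (F : ℝ → PhaseSpace k → PhaseSpace k)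
    (D : ℝ → tangentSpaceOf M x →ₗ[ℝ] tangentSpaceOf M x), 0 < δ ∧ W ∈ 𝓝 x ∧
    (∀ y ∈ W ∩ M, F 0 y = y ∧
      ∀ t ∈ Set.Ioo (-δ) δ, F t y ∈ M ∧ HasDerivAt (fun s => F s y) (X (F t y)) t) ∧
    (∀ t ∈ Set.Ioo (-δ) δ, ∀ (c : ℝ → PhaseSpace k) (v : tangentSpaceOf M x),
      c 0 = x → (∀ᶠ s in 𝓝 (0 : ℝ), c s ∈ M) → HasDerivAt c (v : PhaseSpace k) 0 →
        HasDerivAt (fun s => F t (c s)) (D t v : PhaseSpace k) 0) ∧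
    ∀ v : tangentSpaceOf M x, HasDerivAt (fun t => (D t v : PhaseSpace k)) (L v : PhaseSpace k) 0

/-- The data of a Hamiltonian realization on an open set `Ω ⊆ ℝⁿ`, `n = k + 2`: the rescaling
function `ν`, the Casimirs `C₁, …, C_{n-2}` and the Hamiltonian `H = C_{n-1}`, all smooth on `Ω`.
(Values outside `Ω` play no role.) -/
structure HamiltonianRealization (k : ℕ) where
  Ω : Set (PhaseSpace k)
  ν : PhaseSpace k → ℝ
  C : Fin k → PhaseSpace k → ℝ
  H : PhaseSpace k → ℝ
  isOpen_Ω : IsOpen Ω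
  smooth_ν : ContDiffOn ℝ ∞ ν Ω
  smooth_C : ∀ i, ContDiffOn ℝ ∞ (C i) Ω
  smooth_H : ContDiffOn ℝ ∞ H Ω

namespace HamiltonianRealization

variable {k : ℕ} (S : HamiltonianRealization k)

/-- The Poisson bracket, `{f,g} dx₁∧…∧dxₙ = ν dC₁∧…∧dC_{n-2}∧df∧dg`, i.e. `ν` times the
determinant of the matrix with rows `∇C₁, …, ∇C_{n-2}, ∇f, ∇g`. -/
def bracket (f g : PhaseSpace k → ℝ) (x : PhaseSpace k) : ℝ :=
  S.ν x * Matrix.det (Matrix.of fun i j : Fin (k + 2) =>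
    (Fin.snoc (α := fun _ => PhaseSpace k)
      (Fin.snoc (α := fun _ => PhaseSpace k) (fun l : Fin k => gradient (S.C l) x) (gradient f x))
      (gradient g x) : Fin (k + 2) → PhaseSpace k) i j)

/-- The Hamiltonian vector field `X_h`, with components `{x_i, h}`. -/
def hamiltonianField (h : PhaseSpace k → ℝ) (x : PhaseSpace k) : PhaseSpace k :=
  WithLp.toLp 2 fun i => S.bracket (fun y => y i) h x

/-- The vector field `X = X_H` of the system, `X_i = ν ∂(C₁,…,C_{n-2},x_i,H)/∂(x₁,…,xₙ)`. -/
def field : PhaseSpace k → PhaseSpace k :=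
  S.hamiltonianField S.H

/-- `x` and `y` are joined by a piece of an integral curve, in `Ω`, of the Hamiltonian vector field
of some smooth function on `Ω`. -/
def HamiltonianStep (x y : PhaseSpace k) : Prop :=
  ∃ h : PhaseSpace k → ℝ, ContDiffOn ℝ ∞ h S.Ω ∧
    ∃ (T : ℝ) (c : ℝ → PhaseSpace k), 0 ≤ T ∧ c 0 = x ∧ c T = y ∧
      ∀ t ∈ Set.Icc 0 T, c t ∈ S.Ω ∧
        HasDerivWithinAt c (S.hamiltonianField h (c t)) (Set.Icc 0 T) t

/-- The symplectic leaf through `x ∈ Ω`: the points that can be joined with `x` by finitely many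
pieces of integral curves of Hamiltonian vector fields. (Such a piece run backwards is one for the
opposite Hamiltonian. A leaf through a regular point is an embedded surface, so that its topology
is the subspace topology.) -/
def leaf (x : PhaseSpace k) : Set (PhaseSpace k) :=
  {y | Relation.ReflTransGen S.HamiltonianStep x y}

/-- Regular equilibrium: `ν ≠ 0`, `∇C₁∧…∧∇C_{n-2} ≠ 0` and `∇C₁∧…∧∇C_{n-2}∧∇H = 0` at `x ∈ Ω`. -/
structure IsRegularEquilibrium (x : PhaseSpace k) : Prop where
  mem : x ∈ S.Ω
  ν_ne_zero : S.ν x ≠ 0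
  independent : LinearIndependent ℝ fun i : Fin k => gradient (S.C i) x
  dependent : ¬ LinearIndependent ℝ
    (Fin.snoc (α := fun _ => PhaseSpace k) (fun i : Fin k => gradient (S.C i) x) (gradient S.H x) :
      Fin (k + 1) → PhaseSpace k)

/-- `F_l = H + l₁ C₁ + … + l_{n-2} C_{n-2}`. -/
def augmented (l : Fin k → ℝ) (x : PhaseSpace k) : ℝ :=
  S.H x + ∑ i, l i * S.C i x

/-- `Hess F_l (x) = D(∇F_l)(x)`. -/
def hess (l : Fin k → ℝ) (x : PhaseSpace k) : PhaseSpace k →L[ℝ] PhaseSpace k :=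
  fderiv ℝ (gradient (S.augmented l)) x

/-- `x` is a non-degenerate regular equilibrium, and `l` its multiplier vector, which is uniquely
determined by `x` because `∇C₁(x), …, ∇C_{n-2}(x)` are independent. -/
structure IsNondegenerateEquilibrium (l : Fin k → ℝ) (x : PhaseSpace k) : Prop
    extends S.IsRegularEquilibrium x where
  critical : gradient (S.augmented l) x = 0
  det_ne_zero : (S.hess l x).det ≠ 0

/-- `𝓘_X(x) = ν² det(A) ⟨A⁻¹∇C₁∧…∧A⁻¹∇C_{n-2}, ∇C₁∧…∧∇C_{n-2}⟩` with `A = Hess F_l (x)`, where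
`⟨u₁∧…∧u_m, v₁∧…∧v_m⟩ = det ⟨u_i, v_j⟩` (which is `1` for `m = 0`). -/
def invariant (l : Fin k → ℝ) (x : PhaseSpace k) : ℝ :=
  S.ν x ^ 2 * (S.hess l x).det *
    Matrix.det (Matrix.of fun i j : Fin k =>
      inner ℝ ((S.hess l x).inverse (gradient (S.C i) x)) (gradient (S.C j) x))

end HamiltonianRealization

end

/-! Near a regular point the leaf is an embedded surface on which the system is a planar Hamiltonian
system; the theorem then follows from one linear computation and from planar dynamics.

The surface. Hamiltonian curves preserve the Casimirs, so the leaf lies in their common level set.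
Conversely, if the gradients of the Casimirs together with two vectors `p`, `q` form a basis at the
equilibrium, the Casimirs and the functionals of `p` and `q` are local coordinates. Every nearby
point of the level set is reached along a coordinate ray that is itself an integral curve of a
suitable Hamiltonian field (`exists_driving_hamiltonian`). Hence `exists_isLeafChart`: near the
equilibrium, leaf and level set coincide, and a disc in `ℂ` parametrizes them. The vectors `p` and
`q` remain free, and are chosen later so that the linear part is in normal form.

The linear part. Casimir gradients lie in the kernel of the Poisson tensor `π`, so `H` may be
replaced by `F`, whose gradient vanishes at the equilibrium; the linearization is therefore the
tensor applied to `A v`. Let `e₁`, `e₂` be an orthonormal basis of the tangent plane that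
diagonalizes the compression of `A`, with diagonal entries `l₁`, `l₂`, and put `g = π(e₁, e₂)`. In
this basis the linearization is antidiagonal, with entries `g l₂` and `-g l₁`, and a Gram
determinant identity gives `𝓘 = g² l₁ l₂`. This is the characteristic polynomial. The flow of the
reduced field has derivative `exp (tB)` at the origin, which identifies the linearization in the
required sense.

The dynamics. If `𝓘 < 0`, eigencoordinates exhibit a saddle, and the difference of their squares
grows until the orbit leaves a fixed disc. If `𝓘 > 0`, the linear part can be made a rotation with
angular velocity `√𝓘`, while `F` up to sign is a first integral with a strict minimum on the leaf,
increasing along rays. Orbits are then confined to level curves and keep turning, so they close up.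
Since a level curve meets each ray at most once, each orbit fills its level curve, and the discs
that these curves bound are the sublevel sets of the integral. This yields stability, the family of
orbits, the limit of the periods and the statement on components. -/

open Set Metric Filter

/-! ### Global flows of Lipschitz fields and their derivative at an equilibrium. -/

section GlobalFlow

variable {E : Type*} [NormedAddCommGroup E] [NormedSpace ℝ E]

/-- `φ` is the flow, defined for all times, of the vector field `Y`. -/
structure IsGlobalFlow (Y : E → E) (φ : ℝ → E → E) : Prop where
  zero : ∀ x, φ 0 x = x
  deriv : ∀ x t, HasDerivAt (fun s => φ s x) (Y (φ t x)) t

/-- A bound on the field lets Picard–Lindelöf work on time intervals of any length, since the radius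
of the ball of values can be taken as large as the bound times the length. Solutions on growing
intervals agree by uniqueness and are glued. -/
theorem exists_isGlobalFlow [CompleteSpace E] {Y : E → E} {K L : NNReal} (hY : LipschitzWith K Y)
    (hL : ∀ x, ‖Y x‖ ≤ L) : ∃ φ, IsGlobalFlow Y φ := by
  have key : ∀ x : E, ∃ γ : ℝ → E, γ 0 = x ∧ ∀ t, HasDerivAt γ (Y (γ t)) t := by
    intro x
    have loc : ∀ n : ℕ, ∃ α : ℝ → E, α 0 = x ∧
        ∀ t ∈ Ioo (-(n + 1 : ℝ)) (n + 1), HasDerivAt α (Y (α t)) t := by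
      intro n
      have h0 : (0 : ℝ) ∈ Icc (-(n + 1 : ℝ)) (n + 1) := by
        constructor <;> linarith [n.cast_nonneg (α := ℝ)]
      have hpl : IsPicardLindelof (fun _ => Y) (⟨0, h0⟩ : Icc (-(n + 1 : ℝ)) (n + 1)) x
          (L * (n + 1)) 0 L K := by
        refine IsPicardLindelof.of_time_independent (fun y _ => hL y) hY.lipschitzOnWith ?_
        simp
      obtain ⟨α, hα, h⟩ := hpl.exists_eq_forall_mem_Icc_hasDerivWithinAt₀
      exact ⟨α, hα, fun t ht =>
        (h t (Ioo_subset_Icc_self ht)).hasDerivAt (Icc_mem_nhds ht.1 ht.2)⟩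
    choose α hα hd using loc
    have agree : ∀ m n : ℕ, m ≤ n → EqOn (α m) (α n) (Ioo (-(m + 1 : ℝ)) (m + 1)) := by
      intro m n hmn
      have hmn' : (m : ℝ) ≤ n := by exact_mod_cast hmn
      refine ODE_solution_unique_of_mem_Ioo (v := fun _ => Y) (s := fun _ => univ) (K := K)
        (t₀ := 0) (fun t _ => hY.lipschitzOnWith) ⟨?_, ?_⟩ (fun t ht => ⟨hd m t ht, trivial⟩)
        (fun t ht => ⟨hd n t ⟨by linarith [ht.1], by linarith [ht.2]⟩, trivial⟩)
        ((hα m).trans (hα n).symm)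
      all_goals linarith [m.cast_nonneg (α := ℝ)]
    -- The extra `1` in the length of the intervals puts `t` in the interior of its interval, where
    -- two-sided derivatives are available.
    have hin : ∀ t : ℝ, t ∈ Ioo (-((⌈|t|⌉₊ : ℕ) + 1 : ℝ)) ((⌈|t|⌉₊ : ℕ) + 1) := by
      intro t
      have h1 := Nat.le_ceil |t|
      have h2 := abs_le.1 h1
      constructor <;> linarith [h2.1, h2.2]
    have same : ∀ (n : ℕ) (t : ℝ), t ∈ Ioo (-(n + 1 : ℝ)) (n + 1) → α ⌈|t|⌉₊ t = α n t := by
      intro n t ht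
      rcases le_total ⌈|t|⌉₊ n with h | h
      · exact agree _ _ h (hin t)
      · exact (agree _ _ h ht).symm
    refine ⟨fun t => α ⌈|t|⌉₊ t, by simpa using hα 0, fun t => ?_⟩
    have h1 := hd ⌈|t|⌉₊ t (hin t)
    refine h1.congr_of_eventuallyEq ?_
    filter_upwards [Ioo_mem_nhds (hin t).1 (hin t).2] with s hs
    exact same _ s hs
  choose γ h0 h1 using key
  exact ⟨fun t x => γ x t, h0, h1⟩

theorem hasDerivAt_exp_smul_apply [CompleteSpace E] (B : E →L[ℝ] E) (v : E) :
    HasDerivAt (fun t : ℝ => NormedSpace.exp (t • B) v) (B v) 0 := by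
  have h1 := hasDerivAt_exp_smul_const B (0 : ℝ)
  rw [zero_smul, NormedSpace.exp_zero, one_mul] at h1
  simpa using h1.clm_apply (hasDerivAt_const (0 : ℝ) v)

namespace IsGlobalFlow

variable {Y : E → E} {φ : ℝ → E → E} {K : NNReal}

theorem neg (h : IsGlobalFlow Y φ) : IsGlobalFlow (fun x => -Y x) (fun t => φ (-t)) where
  zero x := by simpa using h.zero x
  deriv x t := by
    have := (h.deriv x (-t)).scomp t (hasDerivAt_neg t)
    simpa [Function.comp_def] using this

theorem continuous_time (h : IsGlobalFlow Y φ) (x : E) : Continuous fun t => φ t x :=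
  continuous_iff_continuousAt.2 fun t => (h.deriv x t).continuousAt

theorem dist_le (h : IsGlobalFlow Y φ) (hY : LipschitzWith K Y) (t : ℝ) (x y : E) :
    dist (φ t x) (φ t y) ≤ dist x y * Real.exp (K * |t|) := by
  have main : ∀ {Y : E → E} {φ : ℝ → E → E}, IsGlobalFlow Y φ → LipschitzWith K Y →
      ∀ t, 0 ≤ t → dist (φ t x) (φ t y) ≤ dist x y * Real.exp (K * t) := by
    intro Y φ h hY t ht
    have := dist_le_of_trajectories_ODE (v := fun _ => Y) (f := fun s => φ s x)
      (g := fun s => φ s y) (a := 0) (b := t) (δ := dist x y) (fun _ => hY)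
      (h.continuous_time x).continuousOn (fun s _ => (h.deriv x s).hasDerivWithinAt)
      (h.continuous_time y).continuousOn (fun s _ => (h.deriv y s).hasDerivWithinAt)
      (by simp [h.zero]) t ⟨ht, le_rfl⟩
    simpa using this
  rcases le_total 0 t with ht | ht
  · simpa [abs_of_nonneg ht] using main h hY t ht
  · have := main h.neg hY.neg (-t) (by linarith)
    simpa [abs_of_nonpos ht] using this

theorem continuous (h : IsGlobalFlow Y φ) (hY : LipschitzWith K Y) :
    Continuous fun p : ℝ × E => φ p.1 p.2 := by
  rw [continuous_iff_continuousAt]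
  rintro ⟨t, x⟩
  rw [ContinuousAt, tendsto_iff_dist_tendsto_zero]
  have h1 : Tendsto (fun p : ℝ × E => dist p.2 x * Real.exp (K * |p.1|) + dist (φ p.1 x) (φ t x))
      (𝓝 (t, x)) (𝓝 0) := by
    have hc : Continuous fun p : ℝ × E =>
        dist p.2 x * Real.exp (K * |p.1|) + dist (φ p.1 x) (φ t x) := by
      have h2 : Continuous fun p : ℝ × E => φ p.1 x := (h.continuous_time x).comp continuous_fst
      exact (by fun_prop : Continuous fun p : ℝ × E => dist p.2 x * Real.exp (K * |p.1|)).add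
        (h2.dist continuous_const)
    simpa using hc.tendsto (t, x)
  exact squeeze_zero (fun _ => dist_nonneg)
    (fun p => (dist_triangle _ (φ p.1 x) _).trans (by gcongr; exact h.dist_le hY _ _ _)) h1

theorem unique (h : IsGlobalFlow Y φ) (hY : LipschitzWith K Y) {c : ℝ → E} {t₀ : ℝ} {x : E}
    (hc : ∀ t, HasDerivAt c (Y (c t)) t) (h0 : c t₀ = φ t₀ x) : c = fun t => φ t x :=
  ODE_solution_unique_univ (v := fun _ => Y) (s := fun _ => univ) (K := K) (t₀ := t₀)
    (fun _ => hY.lipschitzOnWith) (fun t => ⟨hc t, trivial⟩) (fun t => ⟨h.deriv x t, trivial⟩) h0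

theorem add (h : IsGlobalFlow Y φ) (hY : LipschitzWith K Y) (t s : ℝ) (x : E) :
    φ (t + s) x = φ t (φ s x) := by
  have hc : ∀ u, HasDerivAt (fun u => φ (u + s) x) (Y (φ (u + s) x)) u :=
    fun u => (h.deriv x (u + s)).comp_add_const u s
  exact congrFun (h.unique hY hc (t₀ := 0) (x := φ s x) (by simp [h.zero])) t

theorem equilibrium (h : IsGlobalFlow Y φ) (hY : LipschitzWith K Y) {x : E} (hx : Y x = 0)
    (t : ℝ) : φ t x = x := by
  have := h.unique hY (c := fun _ => x) (t₀ := 0) (x := x)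
    (fun t => by simpa [hx] using hasDerivAt_const t x) (h.zero x).symm
  exact (congrFun this t).symm

/-- Variation of constants: `exp (-sB) (φ s z)` has derivative `exp (-sB)` applied to `(Y - B) (φ s
z)`. By Grönwall `φ s z` is bounded by a constant times `z` up to time `t`, so this derivative is
`o(z)` uniformly. Differentiability of the field at the equilibrium alone suffices, without smooth
dependence on initial data. -/
theorem hasFDerivAt_exp [CompleteSpace E] (h : IsGlobalFlow Y φ) (hY : LipschitzWith K Y)
    (h0 : Y 0 = 0) {B : E →L[ℝ] E} (hB : HasFDerivAt Y B 0) (t : ℝ) :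
    HasFDerivAt (φ t) (NormedSpace.exp (t • B)) 0 := by
  have hderiv : ∀ s : ℝ, HasDerivAt (fun s : ℝ => NormedSpace.exp (s • (-B)))
      (NormedSpace.exp (s • (-B)) * (-B)) s := fun s => hasDerivAt_exp_smul_const (-B) s
  have hcont : Continuous fun s : ℝ => NormedSpace.exp (s • (-B)) :=
    continuous_iff_continuousAt.2 fun s => (hderiv s).continuousAt
  obtain ⟨M, hM⟩ := (isCompact_uIcc (a := (0 : ℝ)) (b := t)).exists_bound_of_continuousOn
    hcont.continuousOn
  have hM0 : 0 ≤ M := (norm_nonneg _).trans (hM 0 left_mem_uIcc)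
  set R := Real.exp (K * |t|)
  have hR : 0 < R := Real.exp_pos _
  have hφ0 : φ t 0 = 0 := h.equilibrium hY h0 t
  have main : HasFDerivAt (fun z => NormedSpace.exp (t • (-B)) (φ t z))
      (ContinuousLinearMap.id ℝ E) 0 := by
    rw [hasFDerivAt_iff_isLittleO_nhds_zero]
    simp only [zero_add, hφ0, map_zero, sub_zero, ContinuousLinearMap.id_apply]
    rw [Asymptotics.isLittleO_iff]
    intro c hc
    rw [hasFDerivAt_iff_isLittleO_nhds_zero] at hB
    simp only [zero_add, h0, sub_zero] at hB
    -- The mean value bound below is `M * (η * R) * |t|` times `‖z‖`. The `1` in the denominator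
    -- covers `t = 0`.
    obtain ⟨η, hη, hηc⟩ : ∃ η, 0 < η ∧ M * (η * R) * |t| ≤ c := by
      refine ⟨c / (M * R * |t| + 1), by positivity, ?_⟩
      have h1 : 0 ≤ M * R * |t| := by positivity
      have : M * (c / (M * R * |t| + 1) * R) * |t| = c * ((M * R * |t|) / (M * R * |t| + 1)) := by
        field_simp
      rw [this]
      have : (M * R * |t|) / (M * R * |t| + 1) ≤ 1 := by
        rw [div_le_one (by positivity)]; linarith
      nlinarith
    obtain ⟨ρ, hρ, hb⟩ := Metric.eventually_nhds_iff.1 (Asymptotics.isLittleO_iff.1 hB hη)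
    have hev : ∀ᶠ z : E in 𝓝 0, ‖z‖ * R < ρ := by
      have : Tendsto (fun z : E => ‖z‖ * R) (𝓝 0) (𝓝 0) := by
        have hc : Continuous fun z : E => ‖z‖ * R := by fun_prop
        simpa using hc.tendsto 0
      exact this.eventually (gt_mem_nhds hρ)
    filter_upwards [hev] with z hz
    have hgrow : ∀ s ∈ uIcc 0 t, ‖φ s z‖ ≤ ‖z‖ * R := by
      intro s hs
      have := h.dist_le hY s z 0
      rw [h.equilibrium hY h0, dist_zero_right, dist_zero_right] at this
      have hst : |s| ≤ |t| := by
        have := abs_sub_left_of_mem_uIcc hs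
        simpa using this
      exact this.trans (by simp only [R]; gcongr)
    have hd : ∀ s ∈ uIcc 0 t, HasDerivWithinAt (fun s => NormedSpace.exp (s • (-B)) (φ s z))
        (NormedSpace.exp (s • (-B)) (Y (φ s z) - B (φ s z))) (uIcc 0 t) s := by
      intro s _
      have := ((hderiv s).clm_apply (h.deriv z s)).hasDerivWithinAt (s := uIcc 0 t)
      convert this using 1
      simp [sub_eq_neg_add]
    have hbd : ∀ s ∈ uIcc 0 t, ‖NormedSpace.exp (s • (-B)) (Y (φ s z) - B (φ s z))‖
        ≤ M * (η * R) * ‖z‖ := by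
      intro s hs
      refine (ContinuousLinearMap.le_opNorm _ _).trans ?_
      have h1 : ‖φ s z‖ < ρ := (hgrow s hs).trans_lt hz
      have h2 := hb (y := φ s z) (by simpa using h1)
      calc _ ≤ M * (η * (‖z‖ * R)) := by
            gcongr
            · exact hM s hs
            · exact h2.trans (by gcongr; exact hgrow s hs)
        _ = _ := by ring
    have := (convex_uIcc 0 t).norm_image_sub_le_of_norm_hasDerivWithin_le hd hbd
      left_mem_uIcc right_mem_uIcc
    simp only [zero_smul, NormedSpace.exp_zero, one_apply_eq_self, h.zero] at this
    refine this.trans ?_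
    simp only [sub_zero, Real.norm_eq_abs]
    calc _ = M * (η * R) * |t| * ‖z‖ := by ring
      _ ≤ _ := by gcongr
  have hinv : NormedSpace.exp (t • B) * NormedSpace.exp (t • (-B)) = 1 := by
    let _ : NormedAlgebra ℚ (E →L[ℝ] E) := NormedAlgebra.restrictScalars ℚ ℝ _
    rw [smul_neg, ← NormedSpace.exp_add_of_commute (Commute.neg_right (Commute.refl _))]
    simp
  have := (NormedSpace.exp (t • B)).hasFDerivAt.comp (0 : E) main
  rw [ContinuousLinearMap.comp_id] at this
  refine this.congr_of_eventuallyEq (Eventually.of_forall fun z => ?_)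
  have := congrArg (fun f : E →L[ℝ] E => f (φ t z)) hinv
  simpa using this.symm

end IsGlobalFlow

end GlobalFlow

/-! ### Planar centers: closed orbits, periods and the discs they bound. -/

section PlanarCenter

/-- The origin is a center of the planar field `Y`: its linear part is the rotation with angular
velocity `κ`, and `V` is a first integral in the disc of radius `r` that increases along rays. -/
structure IsPlanarCenter (Y : ℂ → ℂ) (κ r : ℝ) (V : ℂ → ℝ) : Prop where
  κ_pos : 0 < κ
  r_pos : 0 < r
  isLittleO : (fun z => Y z - Complex.I * κ * z) =o[𝓝 0] fun z => z
  continuousOn : ContinuousOn V (ball 0 r)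
  zero : V 0 = 0
  radial : ∀ z ∈ ball (0 : ℂ) r, z ≠ 0 → ∀ s ∈ Ico (0 : ℝ) 1, V (s * z) < V z
  invariant : ∀ z ∈ ball (0 : ℂ) r, ∃ V' : ℂ →L[ℝ] ℝ, HasFDerivAt V V' z ∧ V' (Y z) = 0

namespace IsPlanarCenter

variable {Y : ℂ → ℂ} {κ r : ℝ} {V : ℂ → ℝ} {φ : ℝ → ℂ → ℂ} {K : NNReal}

theorem pos (h : IsPlanarCenter Y κ r V) {z : ℂ} (hz : z ∈ ball (0 : ℂ) r) (hz0 : z ≠ 0) :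
    0 < V z := by
  have := h.radial z hz hz0 0 ⟨le_rfl, one_pos⟩
  simpa [h.zero] using this

/-- Strict growth of `V` along rays makes each level meet each ray at most once. This replaces a
Poincaré return map. -/
theorem eq_one_of_eq (h : IsPlanarCenter Y κ r V) {z : ℂ} {a : ℝ} (hz : z ∈ ball (0 : ℂ) r)
    (hz0 : z ≠ 0) (ha : 0 < a) (haz : (a : ℂ) * z ∈ ball (0 : ℂ) r) (he : V (a * z) = V z) :
    a = 1 := by
  rcases lt_trichotomy a 1 with h1 | h1 | h1
  · exact absurd he (h.radial z hz hz0 a ⟨ha.le, h1⟩).ne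
  · exact h1
  · have ha' : (a : ℂ) ≠ 0 := by exact_mod_cast ha.ne'
    have := h.radial (a * z) haz (mul_ne_zero ha' hz0) a⁻¹
      ⟨(inv_pos.2 ha).le, inv_lt_one_of_one_lt₀ h1⟩
    rw [← mul_assoc, Complex.ofReal_inv, inv_mul_cancel₀ ha', one_mul] at this
    exact absurd he this.ne'

theorem exists_level (h : IsPlanarCenter Y κ r V) {ρ : ℝ} (h0 : 0 < ρ) (hr : ρ < r) :
    ∃ m, 0 < m ∧ ∀ z : ℂ, ‖z‖ = ρ → m ≤ V z := by
  have hsub : sphere (0 : ℂ) ρ ⊆ ball 0 r := fun z hz => by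
    rw [mem_sphere_zero_iff_norm] at hz
    simpa [hz] using hr
  have hne : (sphere (0 : ℂ) ρ).Nonempty := ⟨(ρ : ℂ), by simp [abs_of_pos h0]⟩
  obtain ⟨z, hz, hmin⟩ := (isCompact_sphere (0 : ℂ) ρ).exists_isMinOn hne
    (h.continuousOn.mono hsub)
  refine ⟨V z, h.pos (hsub hz) (ne_of_mem_sphere hz h0.ne'), fun u hu => hmin ?_⟩
  simpa using hu

/-- The times at which the orbit is in the disc and on its initial level form a clopen set. Closed,
because the bounding circle lies at level at least `m`, above that of `z`; open, because `V` has
zero derivative along the orbit. -/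
theorem trapped (h : IsPlanarCenter Y κ r V) (hφ : IsGlobalFlow Y φ) {ρ m : ℝ} (hr : ρ < r)
    (hm : ∀ z : ℂ, ‖z‖ = ρ → m ≤ V z) {z : ℂ} (hz : ‖z‖ < ρ) (hVz : V z < m) (t : ℝ) :
    ‖φ t z‖ < ρ ∧ V (φ t z) = V z := by
  have hc := hφ.continuous_time z
  have hclopen : IsClopen {t | ‖φ t z‖ < ρ ∧ V (φ t z) = V z} := by
    constructor
    · have heq : {t | ‖φ t z‖ < ρ ∧ V (φ t z) = V z}
          = (fun t => φ t z) ⁻¹' (closedBall 0 ρ ∩ V ⁻¹' {V z}) := by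
        ext t
        simp only [mem_ofPred_eq, mem_preimage, mem_inter_iff, mem_closedBall_zero_iff,
          mem_singleton_iff]
        refine ⟨fun ⟨h1, h2⟩ => ⟨h1.le, h2⟩, fun ⟨h1, h2⟩ => ⟨h1.lt_of_ne fun h3 => ?_, h2⟩⟩
        linarith [hm _ h3]
      rw [heq]
      refine IsClosed.preimage hc ?_
      exact (h.continuousOn.mono (closedBall_subset_ball hr)).preimage_isClosed_of_isClosed
        isClosed_closedBall isClosed_singleton
    · rw [Metric.isOpen_iff]
      rintro t ⟨h1, h2⟩
      have ho : IsOpen {t | ‖φ t z‖ < ρ} := isOpen_lt hc.norm continuous_const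
      obtain ⟨δ, hδ, hb⟩ := Metric.isOpen_iff.1 ho t h1
      refine ⟨δ, hδ, fun s hs => ⟨hb hs, ?_⟩⟩
      rw [← h2]
      have hd : ∀ u ∈ ball t δ, HasDerivWithinAt (fun u => V (φ u z)) 0 (ball t δ) u := by
        intro u hu
        have hu' : φ u z ∈ ball (0 : ℂ) r := by
          have : ‖φ u z‖ < ρ := hb hu
          rw [mem_ball_zero_iff]
          linarith
        obtain ⟨V', hV', h0⟩ := h.invariant _ hu'
        have := hV'.comp_hasDerivAt u (hφ.deriv z u)
        rw [h0] at this
        exact this.hasDerivWithinAt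
      have := (convex_ball t δ).norm_image_sub_le_of_norm_hasDerivWithin_le (C := 0) hd
        (by simp) (mem_ball_self hδ) hs
      simpa [sub_eq_zero] using this
  have := hclopen.eq_univ ⟨0, by simp [hφ.zero, hz]⟩
  exact this.ge (mem_univ t)

/-- The logarithm of a nowhere vanishing solution. -/
theorem exists_log (hφ : IsGlobalFlow Y φ) (hY : Continuous Y) {z : ℂ} (hne : ∀ t, φ t z ≠ 0) :
    ∃ w : ℝ → ℂ, w 0 = 0 ∧ (∀ t, φ t z = z * Complex.exp (w t)) ∧
      ∀ t, HasDerivAt w (Y (φ t z) / φ t z) t := by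
  have hc : Continuous fun t => Y (φ t z) / φ t z :=
    (hY.comp (hφ.continuous_time z)).div (hφ.continuous_time z) hne
  have hw : ∀ t, HasDerivAt (fun t => ∫ s in (0 : ℝ)..t, Y (φ s z) / φ s z)
      (Y (φ t z) / φ t z) t := fun t => hc.integral_hasStrictDerivAt 0 t |>.hasDerivAt
  refine ⟨_, by simp, fun t => ?_, hw⟩
  set w := fun t => ∫ s in (0 : ℝ)..t, Y (φ s z) / φ s z with hwdef
  have hq : ∀ t, HasDerivAt (fun t => φ t z * Complex.exp (-w t)) 0 t := by
    intro t
    have h1 : HasDerivAt (fun t => Complex.exp (-w t))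
        (Complex.exp (-w t) * -(Y (φ t z) / φ t z)) t := (hw t).neg.cexp
    have h2 := (hφ.deriv z t).mul h1
    refine h2.congr_deriv ?_
    have := hne t
    field_simp
    ring
  have hconst := is_const_of_deriv_eq_zero (fun t => (hq t).differentiableAt)
    (fun t => (hq t).deriv) t 0
  simp only [hφ.zero] at hconst
  have hw0 : w 0 = 0 := by simp [hwdef]
  rw [hw0, neg_zero, Complex.exp_zero, mul_one] at hconst
  change φ t z = z * Complex.exp (w t)
  rw [Complex.exp_neg, ← div_eq_mul_inv, div_eq_iff (Complex.exp_ne_zero _)] at hconst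
  exact hconst

/-- The imaginary part of the logarithm is the angle, and it grows at a rate between `κ - η` and `κ
+ η`. When it reaches `2π` the orbit is back on the initial ray and on the same level, hence at its
starting point; integrating the rate up to this time gives the estimate of the period. As the angle
takes all real values, the orbit meets every ray and so fills its level curve, which is the last
clause. -/
theorem exists_period (h : IsPlanarCenter Y κ r V) (hφ : IsGlobalFlow Y φ) (hY : Continuous Y)
    {z : ℂ} (hz : z ≠ 0) (hin : ∀ t, φ t z ∈ ball (0 : ℂ) r) (hV : ∀ t, V (φ t z) = V z)
    (hrot : ∀ t, ‖Y (φ t z) - Complex.I * κ * φ t z‖ ≤ κ / 2 * ‖φ t z‖) :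
    ∃ T, 0 < T ∧ φ T z = z ∧ (∀ s ∈ Ioo 0 T, φ s z ≠ z) ∧
      (∀ η, (∀ t, ‖Y (φ t z) - Complex.I * κ * φ t z‖ ≤ η * ‖φ t z‖) →
        |2 * Real.pi - κ * T| ≤ η * T) ∧
      ∀ u ∈ ball (0 : ℂ) r, u ≠ 0 → V u = V z → ∃ t, φ t z = u := by
  have hκ := h.κ_pos
  have hzr : z ∈ ball (0 : ℂ) r := by simpa [hφ.zero] using hin 0
  have hne : ∀ t, φ t z ≠ 0 := by
    intro t h0
    have h1 := hV t
    rw [h0, h.zero] at h1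
    exact (h.pos hzr hz).ne h1
  obtain ⟨w, hw0, hw, hwd⟩ := exists_log hφ hY hne
  have hθ : ∀ t, HasDerivAt (fun t => (w t).im) (Y (φ t z) / φ t z).im t := fun t =>
    Complex.imCLM.hasFDerivAt.comp_hasDerivAt t (hwd t)
  have hbd : ∀ η t, ‖Y (φ t z) - Complex.I * κ * φ t z‖ ≤ η * ‖φ t z‖ →
      |(Y (φ t z) / φ t z).im - κ| ≤ η := by
    intro η t hη
    have h1 : (Y (φ t z) / φ t z).im - κ = ((Y (φ t z) - Complex.I * κ * φ t z) / φ t z).im := by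
      rw [sub_div, mul_div_cancel_right₀ _ (hne t)]
      simp
    rw [h1]
    refine (Complex.abs_im_le_norm _).trans ?_
    rw [norm_div, div_le_iff₀ (norm_pos_iff.2 (hne t))]
    exact hη
  have hlow : ∀ t, κ / 2 ≤ (Y (φ t z) / φ t z).im := fun t => by
    have := (abs_le.1 (hbd _ t (hrot t))).1
    linarith
  have hmono : StrictMono fun t => (w t).im := by
    refine strictMono_of_deriv_pos fun t => ?_
    rw [(hθ t).deriv]
    linarith [hlow t]
  have hcont : Continuous fun t => (w t).im :=
    continuous_iff_continuousAt.2 fun t => (hθ t).continuousAt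
  have hgrow : Monotone fun t => (w t).im - κ / 2 * t := by
    refine monotone_of_deriv_nonneg (fun t => ?_) fun t => ?_
    · exact ((hθ t).sub ((hasDerivAt_id t).const_mul _)).differentiableAt
    · have := ((hθ t).sub ((hasDerivAt_id t).const_mul (κ / 2))).deriv
      simp only [id] at this
      erw [this]
      linarith [hlow t]
  have hsurj : Function.Surjective fun t => (w t).im := by
    refine hcont.surjective ?_ ?_
    · refine tendsto_atTop_mono' _ ?_ (tendsto_id.const_mul_atTop (half_pos hκ))
      filter_upwards [eventually_ge_atTop 0] with t ht
      have := hgrow ht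
      simp only [hw0, Complex.zero_im, mul_zero, sub_zero] at this
      simp only [id]
      linarith
    · refine tendsto_atBot_mono' _ ?_ (tendsto_id.const_mul_atBot (half_pos hκ))
      filter_upwards [eventually_le_atBot 0] with t ht
      have := hgrow ht
      simp only [hw0, Complex.zero_im, mul_zero, sub_zero] at this
      simp only [id]
      linarith
  have hray : ∀ t u, u ∈ ball (0 : ℂ) r → u ≠ 0 → V u = V z → ∀ a : ℝ, 0 < a →
      φ t z = a * u → φ t z = u := by
    intro t u hu hu0 hVu a ha he
    have := h.eq_one_of_eq hu hu0 ha (he ▸ hin t) (by rw [← he, hV, hVu])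
    rw [he, this]
    simp
  obtain ⟨T, hT⟩ := hsurj (2 * Real.pi)
  simp only at hT
  have hT0 : 0 < T := by
    rw [← hmono.lt_iff_lt]
    simp only [hw0, hT, Complex.zero_im]
    positivity
  refine ⟨T, hT0, ?_, ?_, ?_, ?_⟩
  · refine hray T z hzr hz rfl (Real.exp (w T).re) (Real.exp_pos _) ?_
    rw [hw T]
    conv_lhs => rw [← Complex.re_add_im (w T), Complex.exp_add, hT]
    push_cast
    rw [Complex.exp_two_pi_mul_I]
    ring
  · rintro s ⟨hs0, hsT⟩ he
    rw [hw s] at he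
    have h1 : Complex.exp (w s) = 1 := mul_left_cancel₀ hz (he.trans (mul_one z).symm)
    obtain ⟨n, hn⟩ := Complex.exp_eq_one_iff.1 h1
    have him : (w s).im = n * (2 * Real.pi) := by rw [hn]; simp
    have ha := hmono hs0
    have hb := hmono hsT
    simp only [hw0, Complex.zero_im, hT, him] at ha hb
    have hpi := Real.pi_pos
    have h3 : (0 : ℝ) < n := by
      by_contra hcon
      nlinarith
    have h4 : (n : ℝ) < 1 := by
      by_contra hcon
      nlinarith
    have h5 : 0 < n := by exact_mod_cast h3
    have h6 : n < 1 := by exact_mod_cast h4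
    omega
  · intro η hη
    have hd : ∀ t ∈ Icc 0 T, HasDerivWithinAt (fun t => (w t).im - κ * t)
        ((Y (φ t z) / φ t z).im - κ) (Icc 0 T) t := fun t _ => by
      have := ((hθ t).sub ((hasDerivAt_id t).const_mul κ)).hasDerivWithinAt (s := Icc 0 T)
      rw [mul_one] at this
      exact this
    have := (convex_Icc 0 T).norm_image_sub_le_of_norm_hasDerivWithin_le hd
      (fun t _ => hbd η t (hη t)) (left_mem_Icc.2 hT0.le) (right_mem_Icc.2 hT0.le)
    simpa [hw0, hT, abs_of_pos hT0] using this
  · intro u hu hu0 hVu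
    -- At a time when the angle of the orbit is that of `u`, the two points are on the same ray and
    -- on the same level.
    obtain ⟨ξ, hξ⟩ : ∃ ξ, u = z * Complex.exp ξ := ⟨Complex.log (u / z), by
      rw [Complex.exp_log (div_ne_zero hu0 hz)]
      field_simp⟩
    obtain ⟨t, ht⟩ := hsurj ξ.im
    simp only at ht
    refine ⟨t, hray t u hu hu0 hVu (Real.exp ((w t).re - ξ.re)) (Real.exp_pos _) ?_⟩
    have h2 : w t = ((w t).re - ξ.re : ℝ) + ξ := by
      apply Complex.ext <;> simp [ht]
    rw [hw t, hξ]
    conv_lhs => rw [h2, Complex.exp_add]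
    push_cast
    ring

theorem isOpen_sublevel (h : IsPlanarCenter Y κ r V) {ρ : ℝ} (hρ : ρ < r) (a : ℝ) :
    IsOpen {z : ℂ | ‖z‖ < ρ ∧ V z < a} := by
  have := (h.continuousOn.mono (ball_subset_ball hρ.le)).isOpen_inter_preimage isOpen_ball
    (isOpen_Iio (a := a))
  convert this using 1
  ext z
  simp

theorem isCompact_sublevel (h : IsPlanarCenter Y κ r V) {ρ : ℝ} (hρ : ρ < r) (a : ℝ) :
    IsCompact {z : ℂ | ‖z‖ ≤ ρ ∧ V z ≤ a} := by
  have := (h.continuousOn.mono (closedBall_subset_ball hρ)).preimage_isClosed_of_isClosed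
    isClosed_closedBall (isClosed_Iic (a := a))
  convert (isCompact_closedBall (0 : ℂ) ρ).of_isClosed_subset this inter_subset_left using 1
  ext z
  simp

/-- Growth along rays makes the sublevel set star-shaped about the origin. -/
theorem isPreconnected_sublevel (h : IsPlanarCenter Y κ r V) {ρ : ℝ} (h0 : 0 < ρ) (hρ : ρ < r)
    {a : ℝ} (ha : 0 < a) : IsPreconnected {z : ℂ | ‖z‖ < ρ ∧ V z < a} := by
  have hmem : (0 : ℂ) ∈ {z : ℂ | ‖z‖ < ρ ∧ V z < a} := by simp [h0, h.zero, ha]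
  have hstar : StarConvex ℝ (0 : ℂ) {z : ℂ | ‖z‖ < ρ ∧ V z < a} := by
    rw [starConvex_zero_iff]
    rintro z ⟨hz, hVz⟩ s hs0 hs1
    rw [Complex.real_smul]
    refine ⟨?_, ?_⟩
    · rw [norm_mul, Complex.norm_real, Real.norm_of_nonneg hs0]
      nlinarith [norm_nonneg z]
    · rcases eq_or_ne z 0 with rfl | hz0
      · simpa using hVz
      · rcases hs1.eq_or_lt with rfl | hs1
        · simpa using hVz
        · exact (h.radial z (by rw [mem_ball_zero_iff]; linarith) hz0 s ⟨hs0, hs1⟩).trans hVz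
  exact (hstar.isPathConnected hmem).isConnected.isPreconnected

/-- Lyapunov's center theorem in the plane, with the topology of the family of periodic orbits. -/
theorem exists_family (h : IsPlanarCenter Y κ r V) (hφ : IsGlobalFlow Y φ)
    (hY : LipschitzWith K Y) :
    ∃ ε₀ ∈ Ioo (0 : ℝ) r, ∃ T : ℝ → ℝ,
      (∀ ε : ℝ, ε ∈ Ioc 0 ε₀ → (∀ t, φ t ε ≠ 0 ∧ ‖φ t ε‖ < r) ∧ 0 < T ε ∧
        (∀ t, φ (t + T ε) ε = φ t ε) ∧ ∀ s ∈ Ioo 0 (T ε), φ s ε ≠ ε) ∧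
      (∀ ε ∈ Ioc 0 ε₀, ∀ ε' ∈ Ioc 0 ε₀, ε ≠ ε' → ∀ t t', φ t (ε : ℝ) ≠ φ t' (ε' : ℝ)) ∧
      (∀ ρ > 0, ∀ᶠ ε : ℝ in 𝓝[>] (0 : ℝ), ∀ t, ‖φ t (ε : ℝ)‖ < ρ) ∧
      Tendsto T (𝓝[>] (0 : ℝ)) (𝓝 (2 * Real.pi / κ)) ∧
      ∀ ε ∈ Ioc (0 : ℝ) ε₀,
        IsOpen ({0} ∪ ⋃ ε' ∈ Ioo (0 : ℝ) ε, range fun t => φ t ((ε' : ℝ) : ℂ)) ∧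
        IsPreconnected ({0} ∪ ⋃ ε' ∈ Ioo (0 : ℝ) ε, range fun t => φ t ((ε' : ℝ) : ℂ)) ∧
        IsCompact (({0} ∪ ⋃ ε' ∈ Ioo (0 : ℝ) ε, range fun t => φ t ((ε' : ℝ) : ℂ)) ∪
          range fun t => φ t ((ε : ℝ) : ℂ)) := by
  have hκ := h.κ_pos
  have hrot : ∀ η > 0, ∃ ρ > 0, ∀ z : ℂ, ‖z‖ < ρ →
      ‖Y z - Complex.I * κ * z‖ ≤ η * ‖z‖ := by
    intro η hη
    obtain ⟨ρ, hρ, hb⟩ := Metric.eventually_nhds_iff.1 (Asymptotics.isLittleO_iff.1 h.isLittleO hη)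
    exact ⟨ρ, hρ, fun z hz => hb (by simpa using hz)⟩
  obtain ⟨ρ₁, hρ₁, hrot₁⟩ := hrot (κ / 2) (half_pos hκ)
  obtain ⟨ρ, hρ, hρr, hρρ⟩ : ∃ ρ > 0, ρ < r ∧ ρ ≤ ρ₁ :=
    ⟨min ρ₁ (r / 2), lt_min hρ₁ (half_pos h.r_pos),
      (min_le_right _ _).trans_lt (half_lt_self h.r_pos), min_le_left _ _⟩
  obtain ⟨m, hm0, hm⟩ := h.exists_level hρ hρr
  have hVcont : ContinuousAt (fun ε : ℝ => V ε) 0 := by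
    have h1 : ContinuousAt V ((0 : ℝ) : ℂ) := by
      rw [Complex.ofReal_zero]
      exact h.continuousOn.continuousAt (ball_mem_nhds _ h.r_pos)
    exact ContinuousAt.comp (f := fun ε : ℝ => (ε : ℂ)) h1
      Complex.continuous_ofReal.continuousAt
  have hsmall : ∀ ρ' > 0, ∀ m' > 0, ∃ δ > 0, ∀ ε ∈ Ioc 0 δ, ε < ρ' ∧ V (ε : ℝ) < m' := by
    intro ρ' hρ' m' hm'
    have h1 : ∀ᶠ ε : ℝ in 𝓝 0, V ε < m' :=
      hVcont.eventually_lt continuousAt_const (by simpa [h.zero] using hm')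
    obtain ⟨δ, hδ, hb⟩ := Metric.eventually_nhds_iff.1 (h1.and (gt_mem_nhds hρ'))
    refine ⟨δ / 2, half_pos hδ, fun ε hε => ?_⟩
    have := hb (y := ε) (by
      rw [Real.dist_eq, sub_zero, abs_of_pos hε.1]
      linarith [hε.2])
    exact ⟨this.2, this.1⟩
  obtain ⟨ε₀, hε₀, hε₀b⟩ := hsmall ρ hρ m hm0
  have hnorm : ∀ ε : ℝ, 0 < ε → ‖(ε : ℂ)‖ = ε := fun ε hε => by
    rw [Complex.norm_real, Real.norm_of_nonneg hε.le]
  have hne : ∀ ε : ℝ, 0 < ε → (ε : ℂ) ≠ 0 := fun ε hε => by exact_mod_cast hε.ne'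
  have hball : ∀ ε ∈ Ioc 0 ε₀, (ε : ℂ) ∈ ball (0 : ℂ) r := fun ε hε => by
    rw [mem_ball_zero_iff, hnorm _ hε.1]
    linarith [(hε₀b ε hε).1]
  have htrap : ∀ ε ∈ Ioc 0 ε₀, ∀ t, ‖φ t (ε : ℝ)‖ < ρ ∧ V (φ t (ε : ℝ)) = V (ε : ℝ) :=
    fun ε hε t => h.trapped hφ hρr hm (by rw [hnorm _ hε.1]; exact (hε₀b ε hε).1)
      (hε₀b ε hε).2 t
  have htrapr : ∀ ε ∈ Ioc 0 ε₀, ∀ t, φ t (ε : ℝ) ∈ ball (0 : ℂ) r := fun ε hε t => by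
    rw [mem_ball_zero_iff]
    linarith [(htrap ε hε t).1]
  have hVmono : ∀ ε ∈ Ioc 0 ε₀, ∀ ε' ∈ Ioo 0 ε, V (ε' : ℝ) < V (ε : ℝ) := by
    intro ε hε ε' hε'
    have := h.radial ε (hball ε hε) (hne ε hε.1) (ε' / ε)
      ⟨(div_pos hε'.1 hε.1).le, (div_lt_one hε.1).2 hε'.2⟩
    rwa [← Complex.ofReal_mul, div_mul_cancel₀ _ hε.1.ne'] at this
  have hper := fun (ε : ℝ) (hε : ε ∈ Ioc 0 ε₀) => h.exists_period hφ hY.continuous (hne ε hε.1)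
    (htrapr ε hε) (fun t => (htrap ε hε t).2)
    (fun t => hrot₁ _ ((htrap ε hε t).1.trans_le hρρ))
  choose! T hT0 hT hTmin hTest hcover using hper
  -- The orbits inside the one through `ε` fill exactly a sublevel set: by the intermediate value
  -- theorem on the real segment from `0` to `ε`, every lower positive level is that of some `ε'`,
  -- and its level curve is a single orbit. Openness, connectedness and compactness all come from
  -- this description.
  have hD : ∀ ε ∈ Ioc 0 ε₀, {0} ∪ ⋃ ε' ∈ Ioo 0 ε, (range fun t => φ t ((ε' : ℝ) : ℂ))
      = {z : ℂ | ‖z‖ < ρ ∧ V z < V (ε : ℝ)} := by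
    intro ε hε
    ext z
    simp only [singleton_union, mem_insert_iff, mem_iUnion, mem_range, mem_ofPred_eq, exists_prop]
    constructor
    · rintro (rfl | ⟨ε', hε', t, rfl⟩)
      · simpa [h.zero, hρ] using h.pos (hball ε hε) (hne ε hε.1)
      · have := htrap ε' ⟨hε'.1, hε'.2.le.trans hε.2⟩ t
        exact ⟨this.1, this.2 ▸ hVmono ε hε ε' hε'⟩
    · rintro ⟨hz, hVz⟩
      by_cases hz0 : z = 0
      · exact Or.inl hz0
      right
      have hzr : z ∈ ball (0 : ℂ) r := by rw [mem_ball_zero_iff]; linarith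
      have hc : ContinuousOn (fun ε : ℝ => V ε) (Icc 0 ε) := by
        refine h.continuousOn.comp Complex.continuous_ofReal.continuousOn fun x hx => ?_
        rw [mem_ball_zero_iff, Complex.norm_real, Real.norm_of_nonneg hx.1]
        have := (hε₀b ε hε).1
        linarith [hx.2]
      obtain ⟨ε', hε', he⟩ := intermediate_value_Ioo hε.1.le hc
        (show V z ∈ Ioo (V ((0 : ℝ) : ℂ)) (V (ε : ℝ)) from
          ⟨by simpa [h.zero] using h.pos hzr hz0, hVz⟩)
      obtain ⟨t, ht⟩ := hcover ε' ⟨hε'.1, hε'.2.le.trans hε.2⟩ z hzr hz0 he.symm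
      exact ⟨ε', hε', t, ht⟩
  have hshrink : ∀ ρ > 0, ∀ᶠ ε in 𝓝[>] (0 : ℝ), ∀ t, ‖φ t (ε : ℝ)‖ < ρ := by
    intro ρ' hρ'
    obtain ⟨ρ₂, h0, h1, h2⟩ : ∃ ρ₂ > 0, ρ₂ < r ∧ ρ₂ ≤ ρ' :=
      ⟨min ρ' (r / 2), lt_min hρ' (half_pos h.r_pos),
        (min_le_right _ _).trans_lt (half_lt_self h.r_pos), min_le_left _ _⟩
    obtain ⟨m', hm'0, hm'⟩ := h.exists_level h0 h1
    obtain ⟨δ, hδ, hb⟩ := hsmall ρ₂ h0 m' hm'0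
    filter_upwards [Ioc_mem_nhdsGT hδ] with ε hε t
    exact (h.trapped hφ h1 hm' (by rw [hnorm _ hε.1]; exact (hb ε hε).1) (hb ε hε).2 t).1.trans_le
      h2
  refine ⟨ε₀, ⟨hε₀, ?_⟩, T, fun ε hε => ⟨fun t => ⟨?_, ?_⟩, hT0 ε hε, fun t => ?_, hTmin ε hε⟩,
    ?_, hshrink, ?_, ?_⟩
  · exact (hε₀b ε₀ ⟨hε₀, le_rfl⟩).1.trans hρr
  · intro h0
    have := (htrap ε hε t).2
    rw [h0, h.zero] at this
    exact (h.pos (hball ε hε) (hne ε hε.1)).ne this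
  · exact (htrap ε hε t).1.trans hρr
  · rw [hφ.add hY, hT ε hε]
  · have : ∀ ε ∈ Ioc 0 ε₀, ∀ ε' ∈ Ioo 0 ε, ∀ t t', φ t (ε : ℝ) ≠ φ t' (ε' : ℝ) := by
      intro ε hε ε' hε' t t' he
      have h1 := (htrap ε hε t).2
      rw [he, (htrap ε' ⟨hε'.1, hε'.2.le.trans hε.2⟩ t').2] at h1
      exact (hVmono ε hε ε' hε').ne h1
    intro ε hε ε' hε' hee t t' he
    rcases lt_or_gt_of_ne hee with h1 | h1
    · exact this ε' hε' ε ⟨hε.1, h1⟩ t' t he.symm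
    · exact this ε hε ε' ⟨hε'.1, h1⟩ t t' he
  · rw [Metric.tendsto_nhds]
    intro e he
    -- With `η ≤ κ / 2` the estimate `|2π - κT| ≤ ηT` first gives `T ≤ 4π / κ`, and then `|2π / κ -
    -- T| ≤ η (4π / κ) / κ`.
    obtain ⟨η, hη0, hη1, hη⟩ : ∃ η > 0, η ≤ κ / 2 ∧ η * (4 * Real.pi / κ) / κ < e := by
      have hpos : 0 < 4 * Real.pi / κ / κ := by positivity
      refine ⟨min (κ / 2) (e / (2 * (4 * Real.pi / κ / κ))), lt_min (half_pos hκ) (by positivity),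
        min_le_left _ _, ?_⟩
      calc _ = min (κ / 2) (e / (2 * (4 * Real.pi / κ / κ))) * (4 * Real.pi / κ / κ) := by ring
        _ ≤ e / (2 * (4 * Real.pi / κ / κ)) * (4 * Real.pi / κ / κ) := by
            gcongr; exact min_le_right _ _
        _ = e / 2 := by field_simp
        _ < e := half_lt_self he
    obtain ⟨ρ', hρ', hr'⟩ := hrot η hη0
    filter_upwards [hshrink ρ' hρ', Ioc_mem_nhdsGT hε₀] with ε h1 hε
    have h2 := hTest ε hε η fun t => hr' _ (h1 t)
    have h3 := abs_le.1 h2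
    have hTpos := hT0 ε hε
    have hTle : T ε ≤ 4 * Real.pi / κ := by
      rw [le_div_iff₀ hκ]
      nlinarith [h3.1]
    rw [Real.dist_eq, abs_sub_comm]
    have h4 : 2 * Real.pi / κ - T ε = (2 * Real.pi - κ * T ε) / κ := by field_simp
    rw [h4, abs_div, abs_of_pos hκ]
    refine lt_of_le_of_lt ?_ hη
    gcongr
    exact h2.trans (by gcongr)
  · intro ε hε
    have hVpos := h.pos (hball ε hε) (hne ε hε.1)
    have hcpt : ({0} ∪ ⋃ ε' ∈ Ioo (0 : ℝ) ε, range fun t => φ t ((ε' : ℝ) : ℂ)) ∪ (range fun t => φ t ((ε : ℝ) : ℂ))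
        = {z : ℂ | ‖z‖ ≤ ρ ∧ V z ≤ V (ε : ℝ)} := by
      rw [hD ε hε]
      ext z
      simp only [mem_union, mem_range, mem_ofPred_eq]
      constructor
      · rintro (⟨h1, h2⟩ | ⟨t, rfl⟩)
        · exact ⟨h1.le, h2.le⟩
        · exact ⟨(htrap ε hε t).1.le, (htrap ε hε t).2.le⟩
      · rintro ⟨h1, h2⟩
        have h1' : ‖z‖ < ρ := h1.lt_of_ne fun h3 => by linarith [hm z h3, (hε₀b ε hε).2]
        rcases h2.lt_or_eq with h2 | h2
        · exact Or.inl ⟨h1', h2⟩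
        · right
          refine hcover ε hε z (by rw [mem_ball_zero_iff]; linarith) ?_ h2
          rintro rfl
          rw [h.zero] at h2
          exact hVpos.ne h2
    rw [hcpt, hD ε hε]
    exact ⟨h.isOpen_sublevel hρr _, h.isPreconnected_sublevel hρ hρr hVpos,
      h.isCompact_sublevel hρr _⟩

end IsPlanarCenter

end PlanarCenter

/-! ### Gram determinants and the compression of a symmetric operator. -/

section LinearAlgebra

/-- The matrix of inner products is the transposed coordinate matrix of `q` times that of `r`. -/
theorem det_mul_det_eq_det_inner {ι E : Type*} [Fintype ι] [DecidableEq ι] [NormedAddCommGroup E]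
    [InnerProductSpace ℝ E] (b : OrthonormalBasis ι ℝ E) (q r : ι → E) :
    b.toBasis.det q * b.toBasis.det r = (Matrix.of fun i j => inner ℝ (q i) (r j)).det := by
  rw [Module.Basis.det_apply, Module.Basis.det_apply, ← Matrix.det_transpose, ← Matrix.det_mul]
  congr 1
  ext i j
  rw [Matrix.mul_apply, Matrix.of_apply, ← b.sum_inner_mul_inner (q i) (r j)]
  refine Finset.sum_congr rfl fun l _ => ?_
  rw [Matrix.transpose_apply, Module.Basis.toMatrix_apply, Module.Basis.toMatrix_apply,
    OrthonormalBasis.coe_toBasis_repr_apply, OrthonormalBasis.coe_toBasis_repr_apply,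
    b.repr_apply_apply, b.repr_apply_apply, real_inner_comm]

/-- Adapted orthonormal vectors that diagonalize the compression of a symmetric operator to the
orthogonal complement of `n - 2` independent vectors, and the resulting determinant identity. -/
theorem exists_adapted_pair {k : ℕ} {E : Type*} [NormedAddCommGroup E] [InnerProductSpace ℝ E]
    [FiniteDimensional ℝ E] (b : OrthonormalBasis (Fin k ⊕ Fin 2) ℝ E) {c : Fin k → E}
    (hc : LinearIndependent ℝ c) {A : E →ₗ[ℝ] E} (hA : A.IsSymmetric) {A' : E → E}
    (hA' : ∀ i, A (A' (c i)) = c i) :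
    ∃ (e₁ e₂ : E) (l₁ l₂ : ℝ), inner ℝ e₁ e₁ = 1 ∧ inner ℝ e₂ e₂ = 1 ∧ inner ℝ e₁ e₂ = 0 ∧
      (∀ i, inner ℝ (c i) e₁ = 0) ∧ (∀ i, inner ℝ (c i) e₂ = 0) ∧
      inner ℝ e₁ (A e₁) = l₁ ∧ inner ℝ e₂ (A e₂) = l₂ ∧ inner ℝ e₁ (A e₂) = 0 ∧
      (∀ v, (∀ i, inner ℝ (c i) v = 0) → v = inner ℝ e₁ v • e₁ + inner ℝ e₂ v • e₂) ∧
      (∀ v, inner ℝ e₁ v = 0 → inner ℝ e₂ v = 0 → v ∈ Submodule.span ℝ (range c)) ∧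
      LinearMap.det A * (Matrix.of fun i j => inner ℝ (A' (c i)) (c j)).det =
        b.toBasis.det (Sum.elim c ![e₁, e₂]) ^ 2 * (l₁ * l₂) := by
  set T := (Submodule.span ℝ (range c))ᗮ with hT
  have hfin : Module.finrank ℝ T = 2 := by
    have h1 := (Submodule.span ℝ (range c)).finrank_add_finrank_orthogonal
    rw [finrank_span_eq_card hc, Module.finrank_eq_card_basis b.toBasis] at h1
    simp only [Fintype.card_sum, Fintype.card_fin] at h1
    exact Nat.add_left_cancel h1
  set B : T →ₗ[ℝ] T := T.orthogonalProjectionOnto.toLinearMap ∘ₗ A ∘ₗ T.subtype with hB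
  have hBi : ∀ u v : T, inner ℝ u (B v) = inner ℝ (u : E) (A v) := fun u v => by
    simp only [hB, LinearMap.comp_apply, Submodule.subtype_apply, ContinuousLinearMap.coe_coe]
    rw [Submodule.inner_orthogonalProjectionOnto_eq_of_mem_left]
  have hBs : B.IsSymmetric := fun u v => by
    rw [hBi, real_inner_comm, hBi, ← hA, real_inner_comm]
  set e := hBs.eigenvectorBasis hfin with he
  have hon := orthonormal_iff_ite.1 e.orthonormal
  have hmem : ∀ v, (∀ i, inner ℝ (c i) v = 0) ↔ v ∈ T := fun v => by
    rw [hT, Submodule.mem_orthogonal]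
    constructor
    · intro h u hu
      induction hu using Submodule.span_induction with
      | mem x hx => obtain ⟨i, rfl⟩ := hx; exact h i
      | zero => simp
      | add x y _ _ hx hy => rw [inner_add_left, hx, hy, add_zero]
      | smul a x _ hx => rw [inner_smul_left, hx, mul_zero]
    · exact fun h i => h _ (Submodule.subset_span (mem_range_self i))
  have hexp : ∀ v ∈ T, v = inner ℝ (e 0 : E) v • (e 0 : E) + inner ℝ (e 1 : E) v • (e 1 : E) := by
    intro v hv
    have := congrArg (fun t : T => (t : E)) (e.sum_repr' ⟨v, hv⟩)
    simpa [Fin.sum_univ_two] using this.symm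
  have h12 : inner ℝ (e 0 : E) (A (e 1)) = 0 := by
    rw [← hBi, he, hBs.apply_eigenvectorBasis, inner_smul_right, ← he, hon]
    simp
  have h00 : inner ℝ (e 0 : E) (e 0 : E) = (1 : ℝ) := (hon 0 0).trans (if_pos rfl)
  have h11 : inner ℝ (e 1 : E) (e 1 : E) = (1 : ℝ) := (hon 1 1).trans (if_pos rfl)
  have h01 : inner ℝ (e 0 : E) (e 1 : E) = (0 : ℝ) := (hon 0 1).trans (if_neg (by decide))
  have h10 : inner ℝ (e 1 : E) (e 0 : E) = (0 : ℝ) := by rw [real_inner_comm, h01]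
  have hc0 := (hmem (e 0 : E)).2 (e 0).2
  have hc1 := (hmem (e 1 : E)).2 (e 1).2
  refine ⟨e 0, e 1, _, _, h00, h11, h01, hc0, hc1, rfl, rfl, h12,
    fun v hv => hexp v ((hmem v).1 hv), fun v h1 h2 => ?_, ?_⟩
  · rw [← Submodule.orthogonal_orthogonal (Submodule.span ℝ (range c)), Submodule.mem_orthogonal]
    intro u hu
    rw [hexp u hu, inner_add_left, inner_smul_left, inner_smul_left, h1, h2]
    simp
  -- With `q = (c, e)` and `r = (A⁻¹c, e)`, each of the products `det r * det q`, `det q * det q`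
  -- and `det q * det (A ∘ r)` is a block triangular Gram determinant, since `e` is orthogonal to
  -- `c` and `A ∘ r = (c, Ae)`. Eliminating the Gram determinant of `c`, with `det (A ∘ r) = det A *
  -- det r`, gives the identity.
  · set q : Fin k ⊕ Fin 2 → E := Sum.elim c ![(e 0 : E), e 1] with hq
    set r : Fin k ⊕ Fin 2 → E := Sum.elim (fun i => A' (c i)) ![(e 0 : E), e 1] with hr
    have h1 : b.toBasis.det r * b.toBasis.det q =
        (Matrix.of fun i j => inner ℝ (A' (c i)) (c j)).det := by
      rw [det_mul_det_eq_det_inner]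
      have : (Matrix.of fun i j => inner ℝ (r i) (q j)) = Matrix.fromBlocks
          (Matrix.of fun i j => inner ℝ (A' (c i)) (c j))
          (Matrix.of fun i j => inner ℝ (A' (c i)) ((![(e 0 : E), e 1] : Fin 2 → E) j)) 0
          (1 : Matrix (Fin 2) (Fin 2) ℝ) := by
        ext (i | i) (j | j)
        · rfl
        · rfl
        · fin_cases i
          · simpa [hr, hq, real_inner_comm] using hc0 j
          · simpa [hr, hq, real_inner_comm] using hc1 j
        · fin_cases i <;> fin_cases j
          exacts [h00, h01, h10, h11]
      rw [this, Matrix.det_fromBlocks_zero₂₁, Matrix.det_one, mul_one]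
    have h2 : b.toBasis.det q * b.toBasis.det q = (Matrix.of fun i j => inner ℝ (c i) (c j)).det := by
      rw [det_mul_det_eq_det_inner]
      have : (Matrix.of fun i j => inner ℝ (q i) (q j)) = Matrix.fromBlocks
          (Matrix.of fun i j => inner ℝ (c i) (c j))
          (Matrix.of fun i j => inner ℝ (c i) ((![(e 0 : E), e 1] : Fin 2 → E) j)) 0
          (1 : Matrix (Fin 2) (Fin 2) ℝ) := by
        ext (i | i) (j | j)
        · rfl
        · rfl
        · fin_cases i
          · simpa [hr, hq, real_inner_comm] using hc0 j
          · simpa [hr, hq, real_inner_comm] using hc1 j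
        · fin_cases i <;> fin_cases j
          exacts [h00, h01, h10, h11]
      rw [this, Matrix.det_fromBlocks_zero₂₁, Matrix.det_one, mul_one]
    have h3 : b.toBasis.det q * b.toBasis.det (A ∘ r) =
        (Matrix.of fun i j => inner ℝ (c i) (c j)).det *
          (inner ℝ (e 0 : E) (A (e 0)) * inner ℝ (e 1 : E) (A (e 1))) := by
      rw [det_mul_det_eq_det_inner]
      have : (Matrix.of fun i j => inner ℝ (q i) ((A ∘ r) j)) = Matrix.fromBlocks
          (Matrix.of fun i j => inner ℝ (c i) (c j))
          (Matrix.of fun i j => inner ℝ (c i) (A ((![(e 0 : E), e 1] : Fin 2 → E) j))) 0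
          (Matrix.diagonal ![inner ℝ (e 0 : E) (A (e 0)), inner ℝ (e 1 : E) (A (e 1))]) := by
        ext (i | i) (j | j)
        · simp [hq, hr, hA']
        · rfl
        · fin_cases i
          · simpa [hr, hq, hA', real_inner_comm] using hc0 j
          · simpa [hr, hq, hA', real_inner_comm] using hc1 j
        · fin_cases i <;> fin_cases j <;> simp [hr, hq, h12]
          rw [← hA, real_inner_comm, h12]
      rw [this, Matrix.det_fromBlocks_zero₂₁, Matrix.det_diagonal, Fin.prod_univ_two]
      simp
    rw [Module.Basis.det_comp, ← h2] at h3
    rw [← h1]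
    linear_combination h3

end LinearAlgebra

/-! ### Algebra of the Poisson tensor. -/

namespace HamiltonianRealization

variable {k : ℕ} (S : HamiltonianRealization k)

/-- The standard basis of phase space, with its index set split as for `C₁, …, C_{n-2}` and two
further vectors. -/
noncomputable def splitBasis (k : ℕ) : OrthonormalBasis (Fin k ⊕ Fin 2) ℝ (PhaseSpace k) :=
  (EuclideanSpace.basisFun (Fin (k + 2)) ℝ).reindex finSumFinEquiv.symm

/-- The Poisson tensor, as a function of two covectors. -/
noncomputable def poisson (x u w : PhaseSpace k) : ℝ :=
  S.ν x * (splitBasis k).toBasis.det (Sum.elim (fun i => gradient (S.C i) x) ![u, w])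

theorem bracket_eq_poisson (f g : PhaseSpace k → ℝ) (x : PhaseSpace k) :
    S.bracket f g x = S.poisson x (gradient f x) (gradient g x) := by
  rw [bracket, poisson, Module.Basis.det_apply, ← Matrix.det_transpose (Module.Basis.toMatrix _ _),
    ← Matrix.det_submatrix_equiv_self finSumFinEquiv]
  congr 2
  ext i j
  simp only [Matrix.submatrix_apply, Matrix.of_apply, Matrix.transpose_apply,
    Module.Basis.toMatrix_apply, OrthonormalBasis.coe_toBasis_repr_apply, splitBasis,
    OrthonormalBasis.repr_reindex, EuclideanSpace.basisFun_repr, Equiv.symm_symm]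
  refine congrArg (fun v : PhaseSpace k => v (finSumFinEquiv j)) ?_
  rcases i with i | i
  · have : (finSumFinEquiv (Sum.inl i) : Fin (k + 2)) = i.castSucc.castSucc := rfl
    rw [this, Fin.snoc_castSucc, Fin.snoc_castSucc]
    rfl
  · fin_cases i
    · have : (finSumFinEquiv (Sum.inr 0) : Fin (k + 2)) = (Fin.last k).castSucc := rfl
      simp only [Fin.zero_eta]
      rw [this, Fin.snoc_castSucc, Fin.snoc_last]
      rfl
    · have : (finSumFinEquiv (Sum.inr 1) : Fin (k + 2)) = Fin.last (k + 1) := rfl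
      simp only [Fin.mk_one]
      rw [this, Fin.snoc_last]
      rfl

theorem elim_eq_update_left (c : Fin k → PhaseSpace k) (u w : PhaseSpace k) :
    Sum.elim c ![u, w] = Function.update (Sum.elim c ![0, w]) (Sum.inr 0) u := by
  ext1 (i | i)
  · simp
  · fin_cases i <;> simp

theorem poisson_add_left (x u u' w : PhaseSpace k) :
    S.poisson x (u + u') w = S.poisson x u w + S.poisson x u' w := by
  simp only [poisson]
  rw [elim_eq_update_left, elim_eq_update_left _ u, elim_eq_update_left _ u',
    AlternatingMap.map_update_add, mul_add]

theorem poisson_smul_left (x u w : PhaseSpace k) (a : ℝ) :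
    S.poisson x (a • u) w = a * S.poisson x u w := by
  simp only [poisson]
  rw [elim_eq_update_left, elim_eq_update_left _ u, AlternatingMap.map_update_smul, smul_eq_mul]
  ring

theorem poisson_self (x u : PhaseSpace k) : S.poisson x u u = 0 := by
  rw [poisson, AlternatingMap.map_eq_zero_of_eq _ _ (i := Sum.inr 0) (j := Sum.inr 1), mul_zero]
  · simp
  · simp

theorem poisson_antisymm (x u w : PhaseSpace k) : S.poisson x w u = -S.poisson x u w := by
  have : Sum.elim (fun i => gradient (S.C i) x) ![w, u] =
      Sum.elim (fun i => gradient (S.C i) x) ![u, w] ∘ Equiv.swap (Sum.inr 0) (Sum.inr 1) := by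
    ext1 (i | i)
    · simp [Equiv.swap_apply_of_ne_of_ne]
    · fin_cases i <;> simp
  rw [poisson, this, AlternatingMap.map_swap _ _ (by simp), poisson]
  ring

theorem poisson_casimir_left (x w : PhaseSpace k) (i : Fin k) :
    S.poisson x (gradient (S.C i) x) w = 0 := by
  rw [poisson, AlternatingMap.map_eq_zero_of_eq _ _ (i := Sum.inl i) (j := Sum.inr 0), mul_zero]
  · simp
  · simp

/-- The Poisson tensor as a linear map in the second covector. -/
noncomputable def poissonLin (x u : PhaseSpace k) : PhaseSpace k →ₗ[ℝ] ℝ where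
  toFun := S.poisson x u
  map_add' w w' := by
    rw [S.poisson_antisymm x (w + w'), S.poisson_add_left, S.poisson_antisymm x u,
      S.poisson_antisymm x u]
    ring
  map_smul' a w := by
    rw [S.poisson_antisymm x (a • w), S.poisson_smul_left, S.poisson_antisymm x u]
    simp

theorem poissonLin_apply (x u w : PhaseSpace k) : S.poissonLin x u w = S.poisson x u w := rfl

theorem poisson_casimir_right (x u : PhaseSpace k) (i : Fin k) :
    S.poisson x u (gradient (S.C i) x) = 0 := by
  rw [S.poisson_antisymm, S.poisson_casimir_left, neg_zero]

theorem poisson_span (x u : PhaseSpace k) {w : PhaseSpace k}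
    (hw : w ∈ Submodule.span ℝ (range fun i => gradient (S.C i) x)) : S.poisson x u w = 0 := by
  have : Submodule.span ℝ (range fun i => gradient (S.C i) x) ≤ LinearMap.ker (S.poissonLin x u) := by
    rw [Submodule.span_le]
    rintro _ ⟨i, rfl⟩
    exact S.poisson_casimir_right x u i
  exact this hw

theorem gradient_inner_left (p x : PhaseSpace k) : gradient (fun y => inner ℝ p y) x = p := by
  refine HasGradientAt.gradient ?_
  rw [hasGradientAt_iff_hasFDerivAt]
  exact (innerSL ℝ p).hasFDerivAt

/-- The components of the field are brackets with coordinate functions, and the tensor is linear in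
its first covector. From here on the field is handled only through the tensor. -/
theorem inner_hamiltonianField (h : PhaseSpace k → ℝ) (x w : PhaseSpace k) :
    inner ℝ w (S.hamiltonianField h x) = S.poisson x w (gradient h x) := by
  have hcoord : ∀ i : Fin (k + 2), gradient (fun y : PhaseSpace k => y i) x =
      EuclideanSpace.single i (1 : ℝ) := fun i => by
    rw [← gradient_inner_left (EuclideanSpace.single i (1 : ℝ)) x]
    congr 1
    ext y
    simp [EuclideanSpace.inner_single_left]
  have hw : w = ∑ i, w i • EuclideanSpace.single i (1 : ℝ) := by
    ext j
    simp [Finset.sum_apply, Pi.single_apply]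
  have hsum : S.poisson x w (gradient h x) =
      ∑ i, w i * S.poisson x (EuclideanSpace.single i (1 : ℝ)) (gradient h x) := by
    rw [S.poisson_antisymm, ← poissonLin_apply]
    conv_lhs => rw [hw]
    rw [map_sum, ← Finset.sum_neg_distrib]
    refine Finset.sum_congr rfl fun i _ => ?_
    rw [map_smul, poissonLin_apply, S.poisson_antisymm x _ (gradient h x), smul_eq_mul]
    ring
  rw [hsum, PiLp.inner_apply]
  refine Finset.sum_congr rfl fun i _ => ?_
  rw [← hcoord i, ← bracket_eq_poisson]
  simp [hamiltonianField, mul_comm]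

end HamiltonianRealization

/-! ### Smoothness, conservation laws and linearization of Hamiltonian fields. -/

namespace HamiltonianRealization

variable {k : ℕ} (S : HamiltonianRealization k)

section Calculus

variable {S}

theorem differentiableAt_of_contDiffOn {f : PhaseSpace k → ℝ} (hf : ContDiffOn ℝ ∞ f S.Ω)
    {x : PhaseSpace k} (hx : x ∈ S.Ω) : DifferentiableAt ℝ f x :=
  (hf.contDiffAt (S.isOpen_Ω.mem_nhds hx)).differentiableAt (by simp)

theorem hasFDerivAt_of_contDiffOn {f : PhaseSpace k → ℝ} (hf : ContDiffOn ℝ ∞ f S.Ω)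
    {x : PhaseSpace k} (hx : x ∈ S.Ω) : HasFDerivAt f (innerSL ℝ (gradient f x)) x :=
  hasGradientAt_iff_hasFDerivAt.1 (differentiableAt_of_contDiffOn hf hx).hasGradientAt

theorem contDiffOn_gradient {f : PhaseSpace k → ℝ} (hf : ContDiffOn ℝ ∞ f S.Ω) :
    ContDiffOn ℝ ∞ (gradient f) S.Ω :=
  (InnerProductSpace.toDual ℝ (PhaseSpace k)).symm.contDiff.comp_contDiffOn
    (hf.fderiv_of_isOpen S.isOpen_Ω (by simp))

end Calculus

theorem contDiffOn_poisson {u w : PhaseSpace k → PhaseSpace k} (hu : ContDiffOn ℝ ∞ u S.Ω)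
    (hw : ContDiffOn ℝ ∞ w S.Ω) : ContDiffOn ℝ ∞ (fun x => S.poisson x (u x) (w x)) S.Ω := by
  unfold poisson
  refine S.smooth_ν.mul ?_
  simp only [Module.Basis.det_apply, Matrix.det_apply]
  refine ContDiffOn.sum fun σ _ => ContDiffOn.const_smul _ (contDiffOn_prod fun i _ => ?_)
  simp only [Module.Basis.toMatrix_apply, OrthonormalBasis.coe_toBasis_repr_apply, splitBasis,
    OrthonormalBasis.repr_reindex, EuclideanSpace.basisFun_repr, Equiv.symm_symm]
  refine contDiffOn_euclidean.1 ?_ _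
  rcases i with i | i
  · exact contDiffOn_gradient (S.smooth_C i)
  · fin_cases i
    · exact hu
    · exact hw

theorem contDiffOn_hamiltonianField {h : PhaseSpace k → ℝ} (hh : ContDiffOn ℝ ∞ h S.Ω) :
    ContDiffOn ℝ ∞ (S.hamiltonianField h) S.Ω := by
  rw [contDiffOn_euclidean]
  intro i
  have := S.contDiffOn_poisson (u := fun _ => EuclideanSpace.single i (1 : ℝ)) contDiffOn_const
    (contDiffOn_gradient hh)
  refine this.congr fun x _ => ?_
  rw [← inner_hamiltonianField]
  simp [EuclideanSpace.inner_single_left]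

theorem inner_gradient_casimir (h : PhaseSpace k → ℝ) (x : PhaseSpace k) (i : Fin k) :
    inner ℝ (gradient (S.C i) x) (S.hamiltonianField h x) = 0 := by
  rw [inner_hamiltonianField, poisson_casimir_left]

theorem contDiffOn_augmented (l : Fin k → ℝ) : ContDiffOn ℝ ∞ (S.augmented l) S.Ω := by
  unfold augmented
  exact S.smooth_H.add (ContDiffOn.sum fun i _ => contDiffOn_const.mul (S.smooth_C i))

theorem gradient_augmented (l : Fin k → ℝ) {x : PhaseSpace k} (hx : x ∈ S.Ω) :
    gradient (S.augmented l) x = gradient S.H x + ∑ i, l i • gradient (S.C i) x := by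
  refine HasGradientAt.gradient (hasGradientAt_iff_hasFDerivAt.2 ?_)
  have := (hasFDerivAt_of_contDiffOn S.smooth_H hx).add (HasFDerivAt.fun_sum (u := Finset.univ)
    fun i _ => (hasFDerivAt_of_contDiffOn (S.smooth_C i) hx).const_mul (l i))
  refine this.congr_fderiv ?_
  ext v
  simp

/-- Casimir gradients are in the kernel of the tensor, so `H` and the augmented Hamiltonian have the
same field. The latter is critical at the equilibrium. -/
theorem inner_field (l : Fin k → ℝ) {x : PhaseSpace k} (hx : x ∈ S.Ω) (w : PhaseSpace k) :
    inner ℝ w (S.field x) = S.poisson x w (gradient (S.augmented l) x) := by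
  rw [field, inner_hamiltonianField, S.gradient_augmented l hx, ← poissonLin_apply,
    ← poissonLin_apply, map_add, map_sum]
  simp [poissonLin_apply, poisson_casimir_right]

theorem contDiffOn_field : ContDiffOn ℝ ∞ S.field S.Ω :=
  S.contDiffOn_hamiltonianField S.smooth_H

theorem field_eq_zero {l : Fin k → ℝ} {x : PhaseSpace k} (hx : x ∈ S.Ω)
    (hl : gradient (S.augmented l) x = 0) : S.field x = 0 := by
  refine ext_inner_left ℝ fun w => ?_
  rw [S.inner_field l hx, hl, ← poissonLin_apply, map_zero, inner_zero_right]

theorem fderiv_augmented_field (l : Fin k → ℝ) {x : PhaseSpace k} (hx : x ∈ S.Ω) :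
    inner ℝ (gradient (S.augmented l) x) (S.field x) = 0 := by
  rw [S.inner_field l hx, poisson_self]

theorem hasFDerivAt_gradient_augmented (l : Fin k → ℝ) {x : PhaseSpace k} (hx : x ∈ S.Ω) :
    HasFDerivAt (gradient (S.augmented l)) (S.hess l x) x :=
  (((contDiffOn_gradient (S.contDiffOn_augmented l)).contDiffAt
    (S.isOpen_Ω.mem_nhds hx)).differentiableAt (by simp)).hasFDerivAt

theorem hess_isSymmetric (l : Fin k → ℝ) {x : PhaseSpace k} (hx : x ∈ S.Ω) :
    (S.hess l x).toLinearMap.IsSymmetric := by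
  have hF : ContDiffAt ℝ ∞ (S.augmented l) x :=
    (S.contDiffOn_augmented l).contDiffAt (S.isOpen_Ω.mem_nhds hx)
  have hsymm := hF.isSymmSndFDerivAt (by
    rw [minSmoothness_of_isRCLikeNormedField]
    exact WithTop.coe_le_coe.2 le_top)
  have key : ∀ u v, inner ℝ (S.hess l x u) v = fderiv ℝ (fderiv ℝ (S.augmented l)) x u v := by
    intro u v
    have h1 : HasFDerivAt (fun y => InnerProductSpace.toDual ℝ (PhaseSpace k)
        (gradient (S.augmented l) y))
        ((InnerProductSpace.toDual ℝ (PhaseSpace k)).toContinuousLinearEquiv.toContinuousLinearMap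
          ∘L (S.hess l x)) x :=
      (InnerProductSpace.toDual ℝ (PhaseSpace k)).toContinuousLinearEquiv.hasFDerivAt.comp x
        (S.hasFDerivAt_gradient_augmented l hx)
    have h2 : (fun y => InnerProductSpace.toDual ℝ (PhaseSpace k)
        (gradient (S.augmented l) y)) = fderiv ℝ (S.augmented l) := by
      ext1 y
      exact toDual_gradient ..
    rw [h2] at h1
    rw [h1.fderiv]
    rfl
  intro u v
  rw [ContinuousLinearMap.coe_coe, key, hsymm.eq, ← key, real_inner_comm]

theorem poisson_eq_sum (x w u : PhaseSpace k) :
    S.poisson x w u = ∑ j, u j * S.poisson x w (EuclideanSpace.single j (1 : ℝ)) := by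
  have hu : u = ∑ i, u i • EuclideanSpace.single i (1 : ℝ) := by
    ext j
    simp [Finset.sum_apply, Pi.single_apply]
  rw [← poissonLin_apply]
  conv_lhs => rw [hu]
  simp [poissonLin_apply]

/-- The linearization of the field at a critical point of the augmented Hamiltonian. -/
theorem inner_fderiv_field {l : Fin k → ℝ} {x : PhaseSpace k} (hx : x ∈ S.Ω)
    (hl : gradient (S.augmented l) x = 0) (w v : PhaseSpace k) :
    inner ℝ w (fderiv ℝ S.field x v) = S.poisson x w (S.hess l x v) := by
  have hnhds := S.isOpen_Ω.mem_nhds hx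
  have h1 : HasFDerivAt (fun y => inner ℝ w (S.field y))
      (innerSL ℝ w ∘L fderiv ℝ S.field x) x :=
    (innerSL ℝ w).hasFDerivAt.comp x
      ((S.contDiffOn_field.contDiffAt hnhds).differentiableAt (by simp)).hasFDerivAt
  have h2 : ∀ j : Fin (k + 2), HasFDerivAt (fun y => (gradient (S.augmented l) y) j)
      (EuclideanSpace.proj j ∘L S.hess l x) x := fun j =>
    (EuclideanSpace.proj (𝕜 := ℝ) j).hasFDerivAt.comp x (S.hasFDerivAt_gradient_augmented l hx)
  have h3 : ∀ j : Fin (k + 2), DifferentiableAt ℝ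
      (fun y => S.poisson y w (EuclideanSpace.single j (1 : ℝ))) x := fun j =>
    differentiableAt_of_contDiffOn (S.contDiffOn_poisson contDiffOn_const contDiffOn_const) hx
  -- In the product rule the derivatives of the tensor are multiplied by components of the gradient
  -- of the augmented Hamiltonian, which vanish at `x`.
  have h4 := HasFDerivAt.fun_sum (u := Finset.univ) fun j _ => (h2 j).mul (h3 j).hasFDerivAt
  have h5 := h1.unique (h4.congr_of_eventuallyEq (by
    filter_upwards [hnhds] with y hy
    rw [S.inner_field l hy, poisson_eq_sum]
    rfl))
  have h6 := congrArg (fun f : PhaseSpace k →L[ℝ] ℝ => f v) h5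
  rw [poisson_eq_sum]
  simpa [hl, mul_comm] using h6

/-- Along each piece of a Hamiltonian curve the Casimirs have zero derivative. This is the easy
inclusion of the leaf in a level set. -/
theorem leaf_subset {x y : PhaseSpace k} (hx : x ∈ S.Ω) (hy : y ∈ S.leaf x) :
    y ∈ S.Ω ∧ ∀ i, S.C i y = S.C i x := by
  induction hy with
  | refl => exact ⟨hx, fun _ => rfl⟩
  | tail _ hstep ih =>
    obtain ⟨h, _, T, c, hT, rfl, rfl, hc⟩ := hstep
    refine ⟨(hc T ⟨hT, le_rfl⟩).1, fun i => ?_⟩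
    rw [← ih.2 i]
    have hd : ∀ t ∈ Icc 0 T, HasDerivWithinAt (fun t => S.C i (c t)) 0 (Icc 0 T) t := by
      intro t ht
      have := (hasFDerivAt_of_contDiffOn (S.smooth_C i) (hc t ht).1).comp_hasDerivWithinAt t
        (hc t ht).2
      rw [innerSL_apply_apply, inner_gradient_casimir] at this
      exact this
    have := (convex_Icc 0 T).norm_image_sub_le_of_norm_hasDerivWithin_le (C := 0) hd (by simp)
      (left_mem_Icc.2 hT) (right_mem_Icc.2 hT)
    simpa [sub_eq_zero] using this

end HamiltonianRealization

/-! ### Charts of symplectic leaves. -/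

section PlaneMap

variable {k : ℕ}

/-- The pair of linear functionals represented by `p` and `q`, as a map to the complex plane. -/
noncomputable def planeMap (p q : PhaseSpace k) : PhaseSpace k →L[ℝ] ℂ :=
  Complex.equivRealProdCLM.symm.toContinuousLinearMap ∘L (innerSL ℝ p).prod (innerSL ℝ q)

@[simp]
theorem planeMap_re (p q v : PhaseSpace k) : (planeMap p q v).re = inner ℝ p v := rfl

@[simp]
theorem planeMap_im (p q v : PhaseSpace k) : (planeMap p q v).im = inner ℝ q v := rfl

end PlaneMap

namespace HamiltonianRealization

variable {k : ℕ} (S : HamiltonianRealization k)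

/-- `ψ` parametrizes the part in `N` of the leaf through `x` by a disc, the parameters being the
linear coordinates `planeMap p q`. -/
structure IsLeafChart (x p q : PhaseSpace k) (ψ : ℂ → PhaseSpace k) (r : ℝ)
    (N : Set (PhaseSpace k)) : Prop where
  r_pos : 0 < r
  isOpen : IsOpen N
  mem : x ∈ N
  subset : N ⊆ S.Ω
  contDiffOn : ContDiffOn ℝ 1 ψ (ball 0 r)
  zero : ψ 0 = x
  coord : ∀ z ∈ ball (0 : ℂ) r, planeMap p q (ψ z - x) = z
  mem_nhds : ∀ z ∈ ball (0 : ℂ) r, ψ z ∈ N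
  mem_leaf : ∀ z ∈ ball (0 : ℂ) r, ψ z ∈ S.leaf x
  surj : ∀ y ∈ N, y ∈ S.leaf x → planeMap p q (y - x) ∈ ball (0 : ℂ) r ∧
    ψ (planeMap p q (y - x)) = y
  tangent : ∀ z ∈ ball (0 : ℂ) r, ∀ v, (∀ i, inner ℝ (gradient (S.C i) (ψ z)) v = 0) →
    fderiv ℝ ψ z (planeMap p q v) = v

variable {S}

/-- A nonzero value of the tensor means that the Casimir gradients, `p` and `q` form a basis. -/
theorem eq_zero_of_inner_eq_zero {x p q v : PhaseSpace k} (hpq : S.poisson x p q ≠ 0)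
    (hC : ∀ i, inner ℝ (gradient (S.C i) x) v = 0) (hp : inner ℝ p v = 0)
    (hq : inner ℝ q v = 0) : v = 0 := by
  have hdet : IsUnit ((splitBasis k).toBasis.det
      (Sum.elim (fun i => gradient (S.C i) x) ![p, q])) :=
    isUnit_iff_ne_zero.2 (right_ne_zero_of_mul hpq)
  have hspan := ((splitBasis k).toBasis.is_basis_iff_det.2 hdet).2
  have hle : Submodule.span ℝ (range (Sum.elim (fun i => gradient (S.C i) x) ![p, q])) ≤
      (Submodule.span ℝ {v})ᗮ := by
    rw [Submodule.span_le]
    rintro _ ⟨i, rfl⟩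
    rw [SetLike.mem_coe, Submodule.mem_orthogonal_singleton_iff_inner_left]
    rcases i with i | i
    · exact hC i
    · fin_cases i
      · exact hp
      · exact hq
  rw [hspan] at hle
  have := hle (Submodule.mem_top (x := v))
  rwa [Submodule.mem_orthogonal_singleton_iff_inner_left, inner_self_eq_zero] at this

variable (S) in
/-- A Hamiltonian that drives `x` along the curves `t ↦ ψ (t z)` near `x`. -/
theorem exists_driving_hamiltonian {x p q : PhaseSpace k} (hx : x ∈ S.Ω)
    (hpq : S.poisson x p q ≠ 0) :
    ∃ N ∈ 𝓝 x, N ⊆ S.Ω ∧ ∀ z : ℂ, ∃ h : PhaseSpace k → ℝ, ContDiffOn ℝ ∞ h S.Ω ∧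
      ∀ y ∈ N, (∃ t : ℝ, planeMap p q (y - x) = t * z) →
        planeMap p q (S.hamiltonianField h y) = z := by
  set g : PhaseSpace k → ℝ := fun y => S.poisson y p q with hg
  have hgs : ContDiffOn ℝ ∞ g S.Ω := S.contDiffOn_poisson contDiffOn_const contDiffOn_const
  have hO : {y | y ∈ S.Ω ∧ g y ≠ 0} ∈ 𝓝 x :=
    (S.isOpen_Ω.eventually_mem hx).and
      ((hgs.continuousOn.continuousAt (S.isOpen_Ω.mem_nhds hx)).eventually_ne hpq)
  obtain ⟨ρ, hρ, hb⟩ := Metric.nhds_basis_closedBall.mem_iff.1 hO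
  set χ : ContDiffBump x := ⟨ρ / 2, ρ, half_pos hρ, half_lt_self hρ⟩ with hχ
  -- The factor `1 / g` normalizes the speed. The bump function makes the Hamiltonian smooth on all
  -- of `Ω`, as steps in the leaf demand, although `g` may vanish far from `x`.
  set m : PhaseSpace k → ℝ := fun y => χ y * (g y)⁻¹ with hm
  have hms : ContDiffOn ℝ ∞ m S.Ω := by
    intro y hy
    refine ContDiffAt.contDiffWithinAt ?_
    by_cases hyb : y ∈ closedBall x ρ
    · exact χ.contDiff.contDiffAt.mul
        ((hgs.contDiffAt (S.isOpen_Ω.mem_nhds hy)).inv (hb hyb).2)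
    · refine (contDiffAt_const (c := (0 : ℝ))).congr_of_eventuallyEq ?_
      filter_upwards [isClosed_closedBall.isOpen_compl.mem_nhds hyb] with u hu
      have : ρ ≤ dist u x := by
        rw [mem_compl_iff, mem_closedBall, not_le] at hu
        exact hu.le
      simp only [hm]
      rw [χ.zero_of_le_dist this, zero_mul]
  refine ⟨ball x (ρ / 2), ball_mem_nhds _ (half_pos hρ), fun y hy => (hb ?_).1, fun z => ?_⟩
  · exact closedBall_subset_closedBall (half_le_self hρ.le) (ball_subset_closedBall hy)
  -- `L` vanishes where the coordinates are real multiples of `z`, so there the gradient of `L * m`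
  -- is `m` times that of `L`. The tensor sends it to velocity `z` because `m * g = 1`.
  set L : PhaseSpace k → ℝ := fun y => inner ℝ (z.re • q - z.im • p) (y - x) with hL
  have hLs : ContDiff ℝ ∞ L := contDiff_const.inner ℝ (contDiff_id.sub contDiff_const)
  refine ⟨fun y => L y * m y, hLs.contDiffOn.mul hms, fun y hy hyt => ?_⟩
  have hy' : y ∈ closedBall x ρ :=
    closedBall_subset_closedBall (half_le_self hρ.le) (ball_subset_closedBall hy)
  have hyΩ := (hb hy').1
  obtain ⟨t, ht⟩ := hyt
  have hre : inner ℝ p (y - x) = t * z.re := by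
    rw [← planeMap_re p q, ht]
    simp
  have him : inner ℝ q (y - x) = t * z.im := by
    rw [← planeMap_im p q, ht]
    simp
  have hL0 : L y = 0 := by
    simp only [hL]
    rw [inner_sub_left, inner_smul_left, inner_smul_left, hre, him]
    simp
    ring
  have hgrad : gradient (fun y => L y * m y) y = m y • (z.re • q - z.im • p) := by
    refine HasGradientAt.gradient (hasGradientAt_iff_hasFDerivAt.2 ?_)
    have h1 : HasFDerivAt L (innerSL ℝ (z.re • q - z.im • p)) y := by
      have := (innerSL ℝ (z.re • q - z.im • p)).hasFDerivAt.comp y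
        ((hasFDerivAt_id y).sub_const x)
      exact this
    have h2 := h1.mul (hasFDerivAt_of_contDiffOn hms hyΩ)
    refine h2.congr_fderiv ?_
    rw [hL0]
    ext v
    simp
  have hmy : m y * g y = 1 := by
    simp only [hm]
    rw [χ.one_of_mem_closedBall (ball_subset_closedBall hy), one_mul, inv_mul_cancel₀ (hb hy').2]
  have hfield : ∀ w, inner ℝ w (S.hamiltonianField (fun y => L y * m y) y) =
      m y * (z.re * S.poisson y w q - z.im * S.poisson y w p) := by
    intro w
    rw [inner_hamiltonianField, hgrad, ← poissonLin_apply, map_smul, map_sub, map_smul, map_smul]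
    simp [poissonLin_apply]
  apply Complex.ext
  · rw [planeMap_re, hfield, poisson_self]
    linear_combination z.re * hmy
  · rw [planeMap_im, hfield, poisson_self, S.poisson_antisymm]
    linear_combination z.im * hmy

variable (S) in
-- The Casimirs and the two functionals form a local diffeomorphism, and `ψ` is its inverse on the
-- slice where the Casimirs keep their values at `x`. Points of the leaf in the domain are on the
-- slice by conservation of the Casimirs; points of the slice are in the leaf by the driving
-- Hamiltonians.
theorem exists_isLeafChart {x p q : PhaseSpace k} (hx : x ∈ S.Ω) (hpq : S.poisson x p q ≠ 0)
    {U : Set (PhaseSpace k)} (hU : U ∈ 𝓝 x) :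
    ∃ ψ r N, S.IsLeafChart x p q ψ r N ∧ N ⊆ U := by
  set Φ : PhaseSpace k → (Fin k → ℝ) × ℂ :=
    fun y => (fun i => S.C i y - S.C i x, planeMap p q (y - x)) with hΦ
  have hΦd : ∀ y ∈ S.Ω, HasFDerivAt Φ ((ContinuousLinearMap.pi fun i =>
      innerSL ℝ (gradient (S.C i) y)).prod (planeMap p q)) y := by
    intro y hy
    refine HasFDerivAt.prodMk (hasFDerivAt_pi.2 fun i => ?_) ?_
    · exact (hasFDerivAt_of_contDiffOn (S.smooth_C i) hy).sub_const _
    · exact (planeMap p q).hasFDerivAt.comp y ((hasFDerivAt_id y).sub_const x)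
  have hΦs : ContDiffOn ℝ ∞ Φ S.Ω := by
    refine ContDiffOn.prodMk (contDiffOn_pi.2 fun i => (S.smooth_C i).sub contDiffOn_const) ?_
    exact ((planeMap p q).contDiff.comp (contDiff_id.sub contDiff_const)).contDiffOn
  set D : PhaseSpace k →L[ℝ] (Fin k → ℝ) × ℂ := (ContinuousLinearMap.pi fun i =>
      innerSL ℝ (gradient (S.C i) x)).prod (planeMap p q) with hD
  have hinj : Function.Injective D := by
    rw [injective_iff_map_eq_zero]
    intro v hv
    have h1 : (fun i => inner ℝ (gradient (S.C i) x) v) = (0 : Fin k → ℝ) :=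
      congrArg Prod.fst hv
    have h2 : planeMap p q v = 0 := congrArg Prod.snd hv
    refine eq_zero_of_inner_eq_zero hpq (fun i => congrFun h1 i) ?_ ?_
    · rw [← planeMap_re p q, h2, Complex.zero_re]
    · rw [← planeMap_im p q, h2, Complex.zero_im]
  have hfin : Module.finrank ℝ (PhaseSpace k) = Module.finrank ℝ ((Fin k → ℝ) × ℂ) := by
    simp [Module.finrank_prod, Complex.finrank_real_complex]
  set D' : PhaseSpace k ≃L[ℝ] (Fin k → ℝ) × ℂ :=
    (LinearEquiv.ofInjectiveOfFinrankEq D.toLinearMap hinj hfin).toContinuousLinearEquiv with hD'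
  have hDD : (D' : PhaseSpace k →L[ℝ] (Fin k → ℝ) × ℂ) = D := by
    ext1 v
    rfl
  have hΦx : ContDiffAt ℝ 1 Φ x :=
    (hΦs.contDiffAt (S.isOpen_Ω.mem_nhds hx)).of_le (by exact_mod_cast le_top)
  have hΦx' : HasFDerivAt Φ (D' : PhaseSpace k →L[ℝ] (Fin k → ℝ) × ℂ) x := by
    rw [hDD]
    exact hΦd x hx
  set e := hΦx.toOpenPartialHomeomorph Φ hΦx' one_ne_zero with he
  have hex : x ∈ e.source := hΦx.mem_toOpenPartialHomeomorph_source hΦx' one_ne_zero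
  have heΦ : ∀ y, e y = Φ y := fun _ => rfl
  have hΦ0 : Φ x = (0, 0) := by
    simp only [hΦ]
    simp
    rfl
  have he0 : ((0, 0) : (Fin k → ℝ) × ℂ) ∈ e.target := by
    rw [← hΦ0, ← heΦ]
    exact e.map_source hex
  have hes0 : e.symm (0, 0) = x := by
    rw [← hΦ0, ← heΦ]
    exact e.left_inv hex
  have hsmooth : ContDiffAt ℝ 1 e.symm (0, 0) := by
    have := hΦx.to_localInverse hΦx' one_ne_zero
    rw [hΦ0] at this
    exact this
  obtain ⟨N₁, hN₁, hN₁Ω, hdrive⟩ := S.exists_driving_hamiltonian hx hpq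
  set ψ : ℂ → PhaseSpace k := fun z => e.symm (0, z) with hψ
  have hev : ∀ᶠ z : ℂ in 𝓝 0, ((0, z) : (Fin k → ℝ) × ℂ) ∈ e.target ∧
      ContDiffAt ℝ 1 e.symm (0, z) ∧ ψ z ∈ N₁ ∩ interior U := by
    have hc : Tendsto (fun z : ℂ => ((0, z) : (Fin k → ℝ) × ℂ)) (𝓝 0) (𝓝 (0, 0)) :=
      (Continuous.prodMk_right 0).tendsto 0
    have h1 := hc.eventually (e.open_target.mem_nhds he0)
    have h2 := hc.eventually (hsmooth.eventually (by simp))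
    have h3 : Tendsto ψ (𝓝 0) (𝓝 x) := by
      have := hsmooth.continuousAt.tendsto.comp hc
      rwa [hes0] at this
    filter_upwards [h1, h2, h3.eventually (inter_mem hN₁ (interior_mem_nhds.2 hU))] with z a b c using ⟨a, b, c⟩
  obtain ⟨r, hr, hball⟩ := Metric.eventually_nhds_iff_ball.1 hev
  have hright : ∀ z ∈ ball (0 : ℂ) r, Φ (ψ z) = (0, z) := fun z hz => by
    rw [← heΦ]
    exact e.right_inv (hball z hz).1
  have hcoord : ∀ z ∈ ball (0 : ℂ) r, planeMap p q (ψ z - x) = z := fun z hz =>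
    congrArg Prod.snd (hright z hz)
  have hψd : ∀ z ∈ ball (0 : ℂ) r, HasFDerivAt ψ
      (fderiv ℝ e.symm (0, z) ∘L ContinuousLinearMap.inr ℝ (Fin k → ℝ) ℂ) z := by
    intro z hz
    exact ((hball z hz).2.1.differentiableAt one_ne_zero).hasFDerivAt.comp z
      (hasFDerivAt_prodMk_right (0 : Fin k → ℝ) z)
  have htangent : ∀ z ∈ ball (0 : ℂ) r, ∀ v,
      (∀ i, inner ℝ (gradient (S.C i) (ψ z)) v = 0) → fderiv ℝ ψ z (planeMap p q v) = v := by
    intro z hz v hv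
    have hmem : ψ z ∈ e.source := e.map_target (hball z hz).1
    have h1 : HasFDerivAt (fun y => e.symm (Φ y)) (ContinuousLinearMap.id ℝ (PhaseSpace k))
        (ψ z) := by
      refine (hasFDerivAt_id (ψ z)).congr_of_eventuallyEq ?_
      filter_upwards [e.open_source.mem_nhds hmem] with y hy
      exact e.left_inv hy
    have h2 : HasFDerivAt e.symm (fderiv ℝ e.symm (0, z)) (Φ (ψ z)) := by
      rw [hright z hz]
      exact ((hball z hz).2.1.differentiableAt one_ne_zero).hasFDerivAt
    have h3 := h1.unique (h2.comp (ψ z) (hΦd _ (hN₁Ω (hball z hz).2.2.1)))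
    have h4 := congrArg (fun f : PhaseSpace k →L[ℝ] PhaseSpace k => f v) h3
    simp only [ContinuousLinearMap.id_apply, ContinuousLinearMap.comp_apply,
      ContinuousLinearMap.prod_apply] at h4
    rw [(hψd z hz).fderiv]
    conv_rhs => rw [h4]
    simp only [ContinuousLinearMap.comp_apply, ContinuousLinearMap.inr_apply]
    congr 2
    ext i
    simpa using (hv i).symm
  refine ⟨ψ, r, {y | y ∈ e.source ∧ y ∈ interior U ∧ y ∈ S.Ω ∧ ‖planeMap p q (y - x)‖ < r},
    ⟨hr, ?_, ?_, ?_, ?_, hes0, hcoord, ?_, ?_, ?_, htangent⟩, ?_⟩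
  · refine e.open_source.inter (isOpen_interior.inter (S.isOpen_Ω.inter ?_))
    exact isOpen_lt ((planeMap p q).continuous.comp (continuous_id.sub continuous_const)).norm
      continuous_const
  · refine ⟨hex, mem_interior_iff_mem_nhds.2 hU, hx, ?_⟩
    simpa using hr
  · exact fun y hy => hy.2.2.1
  · intro z hz
    refine ContDiffAt.contDiffWithinAt ?_
    exact (hball z hz).2.1.comp z (contDiffAt_const.prodMk contDiffAt_id)
  · intro z hz
    refine ⟨e.map_target (hball z hz).1, (hball z hz).2.2.2, hN₁Ω (hball z hz).2.2.1, ?_⟩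
    rw [hcoord z hz]
    simpa using hz
  · intro z hz
    -- The ray `t ↦ ψ (t z)`, for `t` from `0` to `1`, is an integral curve of `h`: the field of `h`
    -- is tangent to the slice and has coordinates `z` there. One Hamiltonian step thus joins `x` to
    -- `ψ z`.
    obtain ⟨h, hs, hh⟩ := hdrive z
    have hseg : ∀ t ∈ Icc (0 : ℝ) 1, (t : ℂ) * z ∈ ball (0 : ℂ) r := by
      intro t ht
      rw [mem_ball_zero_iff] at hz ⊢
      rw [norm_mul, Complex.norm_real, Real.norm_of_nonneg ht.1]
      nlinarith [norm_nonneg z, ht.2]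
    refine Relation.ReflTransGen.single ⟨h, hs, 1, fun t => ψ (t * z), zero_le_one, ?_, ?_, ?_⟩
    · simpa [hψ] using hes0
    · simp
    · intro t ht
      have hmem := (hball _ (hseg t ht)).2.2.1
      refine ⟨hN₁Ω hmem, ?_⟩
      have h1 : planeMap p q (S.hamiltonianField h (ψ (t * z))) = z :=
        hh _ hmem ⟨t, hcoord _ (hseg t ht)⟩
      have h2 := htangent _ (hseg t ht) (S.hamiltonianField h (ψ (t * z)))
        fun i => S.inner_gradient_casimir h _ i
      rw [h1] at h2
      rw [← h2]
      have h3 : HasDerivAt (fun t : ℝ => (t : ℂ) * z) z t := by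
        simpa using (Complex.ofRealCLM.hasDerivAt (x := t)).mul_const z
      have h4 := (hψd _ (hseg t ht)).differentiableAt.hasFDerivAt.comp_hasDerivAt t h3
      exact h4.hasDerivWithinAt
  · rintro y ⟨hy1, _, hy2, hy3⟩ hyl
    refine ⟨by simpa using hy3, ?_⟩
    have : Φ y = (0, planeMap p q (y - x)) := by
      refine Prod.ext (funext fun i => ?_) rfl
      simp [hΦ, (S.leaf_subset hx hyl).2 i]
    simp only [hψ]
    rw [← this, ← heΦ]
    exact e.left_inv hy1
  · exact fun y hy => interior_subset hy.2.1

end HamiltonianRealization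

/-! ### Uniqueness of integral curves and extension to a global flow. -/

/-- The traces of the two curves form a compact subset of `Ω`, on which the locally Lipschitz field
is Lipschitz. -/
theorem eqOn_of_hasDerivWithinAt_Icc {E : Type*} [NormedAddCommGroup E] [NormedSpace ℝ E]
    {X : E → E} {Ω : Set E} (hΩ : IsOpen Ω) (hX : ContDiffOn ℝ 1 X Ω) {c d : ℝ → E} {T : ℝ}
    (hc : ∀ t ∈ Icc 0 T, c t ∈ Ω ∧ HasDerivWithinAt c (X (c t)) (Icc 0 T) t)
    (hd : ∀ t ∈ Icc 0 T, d t ∈ Ω ∧ HasDerivWithinAt d (X (d t)) (Icc 0 T) t)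
    (h0 : c 0 = d 0) : EqOn c d (Icc 0 T) := by
  have hcc : ContinuousOn c (Icc 0 T) := fun t ht => (hc t ht).2.continuousWithinAt
  have hdc : ContinuousOn d (Icc 0 T) := fun t ht => (hd t ht).2.continuousWithinAt
  have hK : IsCompact (c '' Icc 0 T ∪ d '' Icc 0 T) :=
    (isCompact_Icc.image_of_continuousOn hcc).union (isCompact_Icc.image_of_continuousOn hdc)
  have hKΩ : c '' Icc 0 T ∪ d '' Icc 0 T ⊆ Ω := by
    rintro _ (⟨t, ht, rfl⟩ | ⟨t, ht, rfl⟩)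
    · exact (hc t ht).1
    · exact (hd t ht).1
  have hloc : LocallyLipschitzOn (c '' Icc 0 T ∪ d '' Icc 0 T) X := by
    intro x hx
    obtain ⟨K, t, ht, hl⟩ := (hX.contDiffAt (hΩ.mem_nhds (hKΩ hx))).exists_lipschitzOnWith
    exact ⟨K, t, mem_nhdsWithin_of_mem_nhds ht, hl⟩
  obtain ⟨K, hlip⟩ := hloc.exists_lipschitzOnWith_of_compact hK
  refine ODE_solution_unique_of_mem_Icc_right (v := fun _ => X)
    (s := fun _ => c '' Icc 0 T ∪ d '' Icc 0 T) (K := K) (fun _ _ => hlip) hcc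
    (fun t ht => ?_) (fun t ht => Or.inl (mem_image_of_mem _ (Ico_subset_Icc_self ht))) hdc
    (fun t ht => ?_) (fun t ht => Or.inr (mem_image_of_mem _ (Ico_subset_Icc_self ht))) h0
  · exact (hc t (Ico_subset_Icc_self ht)).2.mono_of_mem_nhdsWithin
      (mem_of_superset (Icc_mem_nhdsGE ht.2) (Icc_subset_Icc_left ht.1))
  · exact (hd t (Ico_subset_Icc_self ht)).2.mono_of_mem_nhdsWithin
      (mem_of_superset (Icc_mem_nhdsGE ht.2) (Icc_subset_Icc_left ht.1))

/-- A `C¹` vector field on a ball agrees on a smaller ball with one that has a global flow. -/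
theorem exists_globalFlow_extension {E : Type*} [NormedAddCommGroup E] [InnerProductSpace ℝ E]
    [FiniteDimensional ℝ E] {Y : E → E} {r : ℝ} (hr : 0 < r)
    (hY : ContDiffOn ℝ 1 Y (ball 0 r)) :
    ∃ (Y' : E → E) (K : NNReal) (φ : ℝ → E → E), LipschitzWith K Y' ∧ IsGlobalFlow Y' φ ∧
      ∀ z ∈ ball (0 : E) (r / 2), Y' z = Y z := by
  have : CompleteSpace E := FiniteDimensional.complete ℝ E
  set χ : ContDiffBump (0 : E) := ⟨r / 2, 3 * r / 4, half_pos hr, by linarith⟩ with hχ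
  have hsupp : tsupport (fun z => χ z • Y z) ⊆ closedBall 0 (3 * r / 4) := by
    refine (tsupport_smul_subset_left _ _).trans ?_
    rw [χ.tsupport_eq]
  have hcomp : HasCompactSupport fun z => χ z • Y z := χ.hasCompactSupport.smul_right
  have hsm : ContDiff ℝ 1 fun z => χ z • Y z := by
    refine contDiff_iff_contDiffAt.2 fun z => ?_
    by_cases hz : z ∈ tsupport fun z => χ z • Y z
    swap
    · exact contDiffAt_const.congr_of_eventuallyEq (notMem_tsupport_iff_eventuallyEq.1 hz)
    have hz' : z ∈ ball (0 : E) r := closedBall_subset_ball (by linarith) (hsupp hz)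
    exact χ.contDiff.contDiffAt.smul (hY.contDiffAt (isOpen_ball.mem_nhds hz'))
  obtain ⟨K, hK⟩ := ContDiff.lipschitzWith_of_hasCompactSupport hcomp hsm one_ne_zero
  obtain ⟨L, hL⟩ := hcomp.exists_bound_of_continuous hsm.continuous
  obtain ⟨φ, hφ⟩ := exists_isGlobalFlow hK (L := ⟨max L 0, le_max_right _ _⟩)
    fun z => (hL z).trans (le_max_left _ _)
  refine ⟨_, K, φ, hK, hφ, fun z hz => ?_⟩
  rw [χ.one_of_mem_closedBall (ball_subset_closedBall hz), one_smul]

theorem hasDerivAt_planeMap_sub {k : ℕ} {c : ℝ → PhaseSpace k} {v : PhaseSpace k}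
    (x p q : PhaseSpace k) (hc : HasDerivAt c v 0) :
    HasDerivAt (fun s => planeMap p q (c s - x)) (planeMap p q v) 0 :=
  (planeMap p q).hasFDerivAt.comp_hasDerivAt (0 : ℝ) (hc.sub_const x)

/-! ### The field, the tangent space and the linearization in a leaf chart. -/

namespace HamiltonianRealization

variable {k : ℕ} {S : HamiltonianRealization k}

namespace IsLeafChart

variable {x p q : PhaseSpace k} {ψ : ℂ → PhaseSpace k} {r : ℝ} {N : Set (PhaseSpace k)}

theorem mem_Ω (h : S.IsLeafChart x p q ψ r N) {z : ℂ} (hz : z ∈ ball (0 : ℂ) r) : ψ z ∈ S.Ω :=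
  h.subset (h.mem_nhds z hz)

theorem zero_mem (h : S.IsLeafChart x p q ψ r N) : (0 : ℂ) ∈ ball (0 : ℂ) r :=
  mem_ball_self h.r_pos

theorem hasFDerivAt (h : S.IsLeafChart x p q ψ r N) {z : ℂ} (hz : z ∈ ball (0 : ℂ) r) :
    HasFDerivAt ψ (fderiv ℝ ψ z) z :=
  ((h.contDiffOn.contDiffAt (isOpen_ball.mem_nhds hz)).differentiableAt one_ne_zero).hasFDerivAt

theorem injOn (h : S.IsLeafChart x p q ψ r N) : InjOn ψ (ball 0 r) := fun z hz w hw he => by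
  rw [← h.coord z hz, he, h.coord w hw]

theorem fderiv_planeMap_field (h : S.IsLeafChart x p q ψ r N) {z : ℂ}
    (hz : z ∈ ball (0 : ℂ) r) :
    fderiv ℝ ψ z (planeMap p q (S.field (ψ z))) = S.field (ψ z) :=
  h.tangent z hz _ fun i => S.inner_gradient_casimir S.H _ i

theorem contDiffOn_reduced (h : S.IsLeafChart x p q ψ r N) :
    ContDiffOn ℝ 1 (fun z => planeMap p q (S.field (ψ z))) (ball 0 r) :=
  (planeMap p q).contDiff.comp_contDiffOn
    ((S.contDiffOn_field.of_le (by exact_mod_cast le_top)).comp h.contDiffOn fun _ hz => h.mem_Ω hz)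

theorem planeMap_fderiv_zero (h : S.IsLeafChart x p q ψ r N) (z : ℂ) :
    planeMap p q (fderiv ℝ ψ 0 z) = z := by
  have h1 := (planeMap p q).hasFDerivAt.comp (0 : ℂ) ((h.hasFDerivAt h.zero_mem).sub_const x)
  have h2 : HasFDerivAt (fun z => planeMap p q (ψ z - x)) (ContinuousLinearMap.id ℝ ℂ) 0 := by
    refine (hasFDerivAt_id (0 : ℂ)).congr_of_eventuallyEq ?_
    filter_upwards [isOpen_ball.mem_nhds h.zero_mem] with z hz using h.coord z hz
  exact congrArg (fun f : ℂ →L[ℝ] ℂ => f z) (h1.unique h2)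

theorem inner_gradient_fderiv_zero (h : S.IsLeafChart x p q ψ r N) (z : ℂ) (i : Fin k) :
    inner ℝ (gradient (S.C i) x) (fderiv ℝ ψ 0 z) = 0 := by
  have hx := h.subset h.mem
  have h1 : HasFDerivAt (fun z => S.C i (ψ z))
      (innerSL ℝ (gradient (S.C i) x) ∘L fderiv ℝ ψ 0) 0 := by
    have := hasFDerivAt_of_contDiffOn (S.smooth_C i) (h.mem_Ω h.zero_mem)
    rw [h.zero] at this
    exact HasFDerivAt.comp (0 : ℂ) (by rwa [h.zero]) (h.hasFDerivAt h.zero_mem)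
  have h2 : HasFDerivAt (fun z => S.C i (ψ z)) (0 : ℂ →L[ℝ] ℝ) 0 := by
    refine (hasFDerivAt_const (S.C i x) (0 : ℂ)).congr_of_eventuallyEq ?_
    filter_upwards [isOpen_ball.mem_nhds h.zero_mem] with z hz
    exact (S.leaf_subset hx (h.mem_leaf z hz)).2 i
  exact congrArg (fun f : ℂ →L[ℝ] ℝ => f z) (h1.unique h2)

/-- The linearization, in the chart, of the field at the center of the chart. -/
theorem hasFDerivAt_reduced (h : S.IsLeafChart x p q ψ r N) :
    HasFDerivAt (fun z => planeMap p q (S.field (ψ z)))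
      (planeMap p q ∘L fderiv ℝ S.field x ∘L fderiv ℝ ψ 0) 0 := by
  have h1 : HasFDerivAt S.field (fderiv ℝ S.field x) (ψ 0) := by
    rw [h.zero]
    exact ((S.contDiffOn_field.contDiffAt
      (S.isOpen_Ω.mem_nhds (h.subset h.mem))).differentiableAt (by simp)).hasFDerivAt
  exact (planeMap p q).hasFDerivAt.comp (0 : ℂ) (h1.comp (0 : ℂ) (h.hasFDerivAt h.zero_mem))

theorem hasDerivAt_lift (h : S.IsLeafChart x p q ψ r N) {c : ℝ → ℂ} {t : ℝ}
    (hct : c t ∈ ball (0 : ℂ) r) (hc : HasDerivAt c (planeMap p q (S.field (ψ (c t)))) t) :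
    HasDerivAt (fun t => ψ (c t)) (S.field (ψ (c t))) t := by
  have := (h.hasFDerivAt hct).comp_hasDerivAt t hc
  rwa [h.fderiv_planeMap_field hct] at this

theorem isOpen_of_isOpen (h : S.IsLeafChart x p q ψ r N) {D : Set ℂ} (hD : IsOpen D) :
    IsOpen (N ∩ (fun y => planeMap p q (y - x)) ⁻¹' D) :=
  h.isOpen.inter (hD.preimage ((planeMap p q).continuous.comp (continuous_id.sub continuous_const)))

theorem inter_leaf_eq_image (h : S.IsLeafChart x p q ψ r N) {D : Set ℂ} (hD : D ⊆ ball 0 r) :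
    (N ∩ (fun y => planeMap p q (y - x)) ⁻¹' D) ∩ S.leaf x = ψ '' D := by
  ext y
  constructor
  · rintro ⟨⟨hN, hyD⟩, hl⟩
    exact ⟨_, hyD, (h.surj y hN hl).2⟩
  · rintro ⟨z, hz, rfl⟩
    have hz' := hD hz
    refine ⟨⟨h.mem_nhds z hz', ?_⟩, h.mem_leaf z hz'⟩
    rw [mem_preimage, h.coord z hz']
    exact hz

theorem eventually_eq_curve (h : S.IsLeafChart x p q ψ r N) {c : ℝ → PhaseSpace k}
    (hc0 : c 0 = x) (hc : ContinuousAt c 0) (hl : ∀ᶠ s in 𝓝 (0 : ℝ), c s ∈ S.leaf x) :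
    ∀ᶠ s in 𝓝 (0 : ℝ), ψ (planeMap p q (c s - x)) = c s := by
  have hN : ∀ᶠ s in 𝓝 (0 : ℝ), c s ∈ N :=
    hc.eventually (h.isOpen.mem_nhds (by rw [hc0]; exact h.mem))
  filter_upwards [hN, hl] with s h1 h2 using (h.surj _ h1 h2).2

/-- A curve in the leaf through `x` is `ψ` of its coordinates near time `0`, so its velocity is
fixed by the derivative of `ψ` after `planeMap`. The fixed vectors form a subspace, which absorbs
the span in the definition; conversely each one is the velocity of the image of a straight line. -/
theorem mem_tangentSpaceOf_iff (h : S.IsLeafChart x p q ψ r N) (v : PhaseSpace k) :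
    v ∈ tangentSpaceOf (S.leaf x) x ↔ fderiv ℝ ψ 0 (planeMap p q v) = v := by
  constructor
  · intro hv
    have hle : tangentSpaceOf (S.leaf x) x ≤ LinearMap.eqLocus
        ((fderiv ℝ ψ 0).toLinearMap ∘ₗ (planeMap p q).toLinearMap) LinearMap.id := by
      refine Submodule.span_le.2 ?_
      rintro v ⟨c, hc0, hl, hd⟩
      have h1 := hasDerivAt_planeMap_sub x p q hd
      have h2 : HasFDerivAt ψ (fderiv ℝ ψ 0) (planeMap p q (c 0 - x)) := by
        rw [hc0, sub_self, map_zero]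
        exact h.hasFDerivAt h.zero_mem
      have h3 := h2.comp_hasDerivAt (0 : ℝ) h1
      exact (h3.congr_of_eventuallyEq
        ((h.eventually_eq_curve hc0 hd.continuousAt hl).mono fun s hs => hs.symm)).unique hd
    exact hle hv
  · intro hv
    refine Submodule.subset_span ⟨fun s => ψ (s * planeMap p q v), ?_, ?_, ?_⟩
    · simp [h.zero]
    · have hcont : Tendsto (fun s : ℝ => (s : ℂ) * planeMap p q v) (𝓝 0) (𝓝 0) := by
        have : Continuous fun s : ℝ => (s : ℂ) * planeMap p q v := by fun_prop
        simpa using this.tendsto 0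
      filter_upwards [hcont.eventually (isOpen_ball.mem_nhds h.zero_mem)] with s hs
      exact h.mem_leaf _ hs
    · have h1 : HasDerivAt (fun s : ℝ => (s : ℂ) * planeMap p q v) (planeMap p q v) 0 := by
        simpa using (Complex.ofRealCLM.hasDerivAt (x := (0 : ℝ))).mul_const (planeMap p q v)
      have h2 : HasFDerivAt ψ (fderiv ℝ ψ 0) (((0 : ℝ) : ℂ) * planeMap p q v) := by
        simpa using h.hasFDerivAt h.zero_mem
      have h3 := h2.comp_hasDerivAt (0 : ℝ) h1
      rw [hv] at h3
      exact h3

/-- The tangent space of the leaf in the coordinates of the chart. -/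
noncomputable def tangentEquiv (h : S.IsLeafChart x p q ψ r N) :
    tangentSpaceOf (S.leaf x) x ≃ₗ[ℝ] ℂ where
  toFun v := planeMap p q (v : PhaseSpace k)
  map_add' u v := by simp
  map_smul' a v := by simp
  invFun z := ⟨fderiv ℝ ψ 0 z, by
    rw [h.mem_tangentSpaceOf_iff, h.planeMap_fderiv_zero]⟩
  left_inv v := Subtype.ext ((h.mem_tangentSpaceOf_iff _).1 v.2)
  right_inv z := h.planeMap_fderiv_zero z

/-- The flow of the reduced field, transported by the chart, is the flow on the leaf. Its derivative
at the equilibrium is conjugate to `exp (tB)`, so the linearization is conjugate to `B`. -/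
theorem exists_isLinearizationOn (h : S.IsLeafChart x p q ψ r N) (hx : S.field x = 0) :
    ∃ L : tangentSpaceOf (S.leaf x) x →ₗ[ℝ] tangentSpaceOf (S.leaf x) x,
      IsLinearizationOn S.field (S.leaf x) x L ∧
      L.charpoly = (planeMap p q ∘L fderiv ℝ S.field x ∘L fderiv ℝ ψ 0).toLinearMap.charpoly := by
  set B : ℂ →L[ℝ] ℂ := planeMap p q ∘L fderiv ℝ S.field x ∘L fderiv ℝ ψ 0 with hB
  obtain ⟨Y, K, φ, hYK, hφ, hYY⟩ := exists_globalFlow_extension h.r_pos h.contDiffOn_reduced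
  have hr2 : ball (0 : ℂ) (r / 2) ⊆ ball 0 r := ball_subset_ball (half_le_self h.r_pos.le)
  have h02 : (0 : ℂ) ∈ ball (0 : ℂ) (r / 2) := mem_ball_self (half_pos h.r_pos)
  have hY0 : Y 0 = 0 := by rw [hYY 0 h02, h.zero, hx, map_zero]
  have hYB : HasFDerivAt Y B 0 := by
    refine h.hasFDerivAt_reduced.congr_of_eventuallyEq ?_
    filter_upwards [isOpen_ball.mem_nhds h02] with z hz using hYY z hz
  refine ⟨h.tangentEquiv.symm.conj B.toLinearMap, ?_, LinearEquiv.charpoly_conj _ _⟩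
  set R := Real.exp (K * 1) with hR
  have hRpos : 0 < R := Real.exp_pos _
  -- Up to time `1` the flow expands distances to the origin by at most `R`; from this radius it
  -- stays in the disc of radius `r / 2`, where the extended field is the true one.
  set W : Set (PhaseSpace k) :=
    N ∩ (fun y => planeMap p q (y - x)) ⁻¹' ball 0 (r / 2 / R) with hW
  have hWo : IsOpen W := h.isOpen_of_isOpen isOpen_ball
  have hxW : x ∈ W := by
    refine ⟨h.mem, ?_⟩
    simp only [mem_preimage, sub_self, map_zero]
    exact mem_ball_self (by have := h.r_pos; positivity)
  have hflow : ∀ z : ℂ, ‖z‖ < r / 2 / R → ∀ t ∈ Ioo (-1 : ℝ) 1, φ t z ∈ ball (0 : ℂ) (r / 2) := by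
    intro z hz t ht
    have h1 := hφ.dist_le hYK t z 0
    rw [hφ.equilibrium hYK hY0, dist_zero_right, dist_zero_right] at h1
    rw [mem_ball_zero_iff]
    refine h1.trans_lt ?_
    have h2 : Real.exp (K * |t|) ≤ R := by
      refine Real.exp_le_exp.2 ?_
      gcongr
      exact (abs_lt.2 ht).le
    calc ‖z‖ * Real.exp (K * |t|) ≤ ‖z‖ * R := by gcongr
      _ < r / 2 := by rwa [lt_div_iff₀ hRpos] at hz
  refine ⟨1, W, fun t y => ψ (φ t (planeMap p q (y - x))),
    fun t => h.tangentEquiv.symm.conj (NormedSpace.exp (t • B)).toLinearMap, one_pos,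
    hWo.mem_nhds hxW, ?_, ?_, ?_⟩
  · rintro y ⟨⟨hyN, hyr⟩, hyl⟩
    rw [mem_preimage, mem_ball_zero_iff] at hyr
    refine ⟨(congrArg ψ (hφ.zero _)).trans (h.surj y hyN hyl).2, fun t ht => ⟨?_, ?_⟩⟩
    · exact h.mem_leaf _ (hr2 (hflow _ hyr t ht))
    · refine h.hasDerivAt_lift (c := fun s => φ s (planeMap p q (y - x)))
        (hr2 (hflow _ hyr t ht)) ?_
      have := hφ.deriv (planeMap p q (y - x)) t
      rwa [hYY _ (hflow _ hyr t ht)] at this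
  · intro t _ c v hc0 _ hd
    have h1 := hasDerivAt_planeMap_sub x p q hd
    have h0 : planeMap p q (c 0 - x) = 0 := by rw [hc0, sub_self, map_zero]
    have h2 : HasFDerivAt (φ t) (NormedSpace.exp (t • B)) (planeMap p q (c 0 - x)) := by
      rw [h0]
      exact hφ.hasFDerivAt_exp hYK hY0 hYB t
    have h3 : HasFDerivAt ψ (fderiv ℝ ψ 0) (φ t (planeMap p q (c 0 - x))) := by
      rw [h0, hφ.equilibrium hYK hY0]
      exact h.hasFDerivAt h.zero_mem
    exact h3.comp_hasDerivAt (0 : ℝ) (h2.comp_hasDerivAt (0 : ℝ) h1)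
  · intro v
    exact (fderiv ℝ ψ 0).hasFDerivAt.comp_hasDerivAt (0 : ℝ)
      (hasDerivAt_exp_smul_apply B (planeMap p q (v : PhaseSpace k)))

end IsLeafChart

end HamiltonianRealization

/-! ### Saddles and centers on the leaf. -/

namespace HamiltonianRealization

variable {k : ℕ} {S : HamiltonianRealization k}

namespace IsLeafChart

variable {x p q : PhaseSpace k} {ψ : ℂ → PhaseSpace k} {r : ℝ} {N : Set (PhaseSpace k)}

/-- A hyperbolic saddle in the chart is unstable. -/
theorem unstableOn (h : S.IsLeafChart x p q ψ r N) (hx : S.field x = 0) {μ : ℝ} (hμ : 0 < μ)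
    (hB : ∀ z, (planeMap p q ∘L fderiv ℝ S.field x ∘L fderiv ℝ ψ 0) z =
      ⟨μ * z.re, -(μ * z.im)⟩) : UnstableOn S.field (S.leaf x) x := by
  intro hst
  set Y : ℂ → ℂ := fun z => planeMap p q (S.field (ψ z)) with hY
  have hlin := h.hasFDerivAt_reduced
  rw [hasFDerivAt_iff_isLittleO_nhds_zero] at hlin
  simp only [zero_add, h.zero, hx, map_zero, sub_zero] at hlin
  obtain ⟨ρ, hρ, hb⟩ := Metric.eventually_nhds_iff.1 (Asymptotics.isLittleO_iff.1 hlin (half_pos hμ))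
  -- The linear part contributes `2 * μ * ‖z‖ ^ 2`. A nonlinear error of at most `μ / 2 * ‖z‖` costs
  -- half of it.
  have hbound : ∀ z : ℂ, ‖z‖ < ρ → μ * (z.re ^ 2 + z.im ^ 2) ≤
      2 * (z.re * (Y z).re - z.im * (Y z).im) := by
    intro z hz
    have h1 := hb (y := z) (by simpa using hz)
    rw [hB] at h1
    set w : ℂ := Y z - ⟨μ * z.re, -(μ * z.im)⟩ with hw
    have hre : (Y z).re = μ * z.re + w.re := by simp [hw]
    have him : (Y z).im = -(μ * z.im) + w.im := by simp [hw]
    have h2 : ‖w‖ ≤ μ / 2 * ‖z‖ := h1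
    have h3 : |z.re * w.re - z.im * w.im| ≤ ‖z‖ * ‖w‖ := by
      have := Complex.abs_re_le_norm (z * w)
      rwa [Complex.mul_re, norm_mul] at this
    have h4 : z.re ^ 2 + z.im ^ 2 = ‖z‖ ^ 2 := by
      rw [← Complex.normSq_eq_norm_sq, Complex.normSq_apply]
      ring
    rw [hre, him]
    have h5 : ‖z‖ * ‖w‖ ≤ μ / 2 * ‖z‖ ^ 2 := by nlinarith [norm_nonneg z]
    have h6 := (abs_le.1 h3).1
    nlinarith
  set U : Set (PhaseSpace k) := N ∩ (fun y => planeMap p q (y - x)) ⁻¹' ball 0 ρ with hU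
  have hxU : x ∈ U := ⟨h.mem, by simpa using hρ⟩
  obtain ⟨V, hVo, hxV, hVU, hV⟩ := hst U (h.isOpen_of_isOpen isOpen_ball) hxU
  obtain ⟨a, ha0, har, haV⟩ : ∃ a : ℝ, 0 < a ∧ (a : ℂ) ∈ ball (0 : ℂ) r ∧ ψ a ∈ V := by
    have h1 : ∀ᶠ z : ℂ in 𝓝 0, z ∈ ball (0 : ℂ) r ∧ ψ z ∈ V :=
      (isOpen_ball.eventually_mem h.zero_mem).and
        ((h.hasFDerivAt h.zero_mem).continuousAt.eventually
          (hVo.mem_nhds (by rw [h.zero]; exact hxV)))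
    have h2 : Tendsto (fun a : ℝ => (a : ℂ)) (𝓝[>] 0) (𝓝 0) := by
      have := Complex.continuous_ofReal.tendsto (0 : ℝ)
      rw [Complex.ofReal_zero] at this
      exact this.mono_left nhdsWithin_le_nhds
    obtain ⟨a, ⟨ha1, ha2⟩, ha3⟩ := ((h2.eventually h1).and self_mem_nhdsWithin).exists
    exact ⟨a, ha3, ha1, ha2⟩
  have hstep := hV (ψ a) ⟨haV, h.mem_leaf _ har⟩
  -- By this time the function `G` below, which starts at `a ^ 2` and grows at rate at least `μ * a
  -- ^ 2`, would exceed `ρ ^ 2`.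
  obtain ⟨t, ht0, htρ⟩ : ∃ t : ℝ, 0 ≤ t ∧ ρ ^ 2 < a ^ 2 + μ * a ^ 2 * t := by
    refine ⟨ρ ^ 2 / (μ * a ^ 2), by positivity, ?_⟩
    rw [mul_div_cancel₀ _ (by positivity)]
    nlinarith
  obtain ⟨z, hzU, c, hc0, hct, hc⟩ := hstep t ht0
  have hxΩ := h.subset h.mem
  -- Stability gives a possibly different curve for each final time, and controls only its endpoint.
  -- By uniqueness all of them are restrictions of `c`, so `c` stays in `U` throughout.
  have hcU : ∀ s ∈ Icc 0 t, c s ∈ U := by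
    intro s hs
    obtain ⟨z', hz'U, d, hd0, hds, hd⟩ := hstep s hs.1
    have hsub : Icc 0 s ⊆ Icc 0 t := Icc_subset_Icc_right hs.2
    have heq := eqOn_of_hasDerivWithinAt_Icc S.isOpen_Ω
      (S.contDiffOn_field.of_le (by exact_mod_cast le_top)) (c := c) (d := d) (T := s)
      (fun u hu => ⟨(S.leaf_subset hxΩ (hc u (hsub hu)).1).1, (hc u (hsub hu)).2.mono hsub⟩)
      (fun u hu => ⟨(S.leaf_subset hxΩ (hd u hu).1).1, (hd u hu).2⟩) (hc0.trans hd0.symm)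
    rw [heq ⟨hs.1, le_rfl⟩, hds]
    exact hz'U
  set w : ℝ → ℂ := fun s => planeMap p q (c s - x) with hw
  have hwd : ∀ s ∈ Icc 0 t, HasDerivWithinAt w (Y (w s)) (Icc 0 t) s := by
    intro s hs
    have h1 : ψ (w s) = c s := (h.surj _ (hcU s hs).1 (hc s hs).1).2
    have h2 := (planeMap p q).hasFDerivAt.comp_hasDerivWithinAt s ((hc s hs).2.sub_const x)
    simp only [hY, h1]
    exact h2
  have hwρ : ∀ s ∈ Icc 0 t, ‖w s‖ < ρ := fun s hs => by
    exact mem_ball_zero_iff.1 (hcU s hs).2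
  -- The first bound keeps `G` at least `a ^ 2`, hence the squared norm too; this makes the growth
  -- rate uniform.
  set G : ℝ → ℝ := fun s => (w s).re ^ 2 - (w s).im ^ 2 with hG
  have hGd : ∀ s ∈ Icc 0 t, HasDerivWithinAt G
      (2 * ((w s).re * (Y (w s)).re - (w s).im * (Y (w s)).im)) (Icc 0 t) s := by
    intro s hs
    have h1 : HasDerivWithinAt (fun s => (w s).re) (Y (w s)).re (Icc 0 t) s :=
      Complex.reCLM.hasFDerivAt.comp_hasDerivWithinAt s (hwd s hs)
    have h2 : HasDerivWithinAt (fun s => (w s).im) (Y (w s)).im (Icc 0 t) s :=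
      Complex.imCLM.hasFDerivAt.comp_hasDerivWithinAt s (hwd s hs)
    refine ((h1.pow 2).sub (h2.pow 2)).congr_deriv ?_
    simp
    ring
  have hmono : ∀ e : ℝ, (∀ s ∈ Icc 0 t, e ≤
      2 * ((w s).re * (Y (w s)).re - (w s).im * (Y (w s)).im)) →
      ∀ s ∈ Icc 0 t, G 0 + e * s ≤ G s := by
    intro e he s hs
    have hd : ∀ u ∈ Icc 0 t, HasDerivWithinAt (fun u => G u - e * u)
        (2 * ((w u).re * (Y (w u)).re - (w u).im * (Y (w u)).im) - e) (Icc 0 t) u := fun u hu => by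
      refine ((hGd u hu).sub ((hasDerivWithinAt_id u _).const_mul e)).congr_deriv (by simp)
    have hm : MonotoneOn (fun u => G u - e * u) (Icc 0 t) := by
      refine monotoneOn_of_hasDerivWithinAt_nonneg (convex_Icc 0 t)
        (fun u hu => (hd u hu).continuousWithinAt)
        (fun u hu => (hd u (interior_subset hu)).mono interior_subset) fun u hu => ?_
      linarith [he u (interior_subset hu)]
    have := hm ⟨le_rfl, ht0⟩ hs hs.1
    simp only [mul_zero, sub_zero] at this
    linarith
  have hG0 : G 0 = a ^ 2 := by
    have : w 0 = a := by rw [hw]; simp only [hc0]; exact h.coord _ har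
    simp [hG, this]
  have hGa : ∀ s ∈ Icc 0 t, a ^ 2 ≤ G s := fun s hs => by
    have := hmono 0 (fun u hu => le_trans (by positivity) (hbound _ (hwρ u hu))) s hs
    linarith
  have hfinal := hmono (μ * a ^ 2) (fun s hs => by
    refine le_trans ?_ (hbound _ (hwρ s hs))
    gcongr
    have := hGa s hs
    simp only [hG] at this
    nlinarith [sq_nonneg (w s).im]) t ⟨ht0, le_rfl⟩
  have hGle : G t ≤ ρ ^ 2 := by
    have h1 := hwρ t ⟨ht0, le_rfl⟩
    have h2 : (w t).re ^ 2 + (w t).im ^ 2 = ‖w t‖ ^ 2 := by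
      rw [← Complex.normSq_eq_norm_sq, Complex.normSq_apply]
      ring
    have h3 : ‖w t‖ ^ 2 ≤ ρ ^ 2 := by gcongr
    simp only [hG]
    nlinarith [sq_nonneg (w t).im]
  linarith

/-- The first integral is the augmented Hamiltonian on the leaf, with a factor `s` that turns the
critical point into a minimum. Since its Hessian on the tangent plane is definite, the integral
increases along short rays. -/
theorem exists_isPlanarCenter (h : S.IsLeafChart x p q ψ r N) (hx : S.field x = 0) {κ : ℝ}
    (hκ : 0 < κ) (hB : ∀ z, (planeMap p q ∘L fderiv ℝ S.field x ∘L fderiv ℝ ψ 0) z =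
      Complex.I * κ * z) {l : Fin k → ℝ} (hl : gradient (S.augmented l) x = 0) {s m : ℝ}
    (hm : 0 < m) (hpos : ∀ z, m * ‖z‖ ^ 2 ≤
      s * inner ℝ (S.hess l x (fderiv ℝ ψ 0 z)) (fderiv ℝ ψ 0 z)) {Y : ℂ → ℂ} {R : ℝ}
    (hR : 0 < R) (hRr : R ≤ r) (hY : ∀ z ∈ ball (0 : ℂ) R, Y z = planeMap p q (S.field (ψ z))) :
    ∃ r' ≤ R, IsPlanarCenter Y κ r' fun z => s * (S.augmented l (ψ z) - S.augmented l x) := by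
  have hxΩ := h.subset h.mem
  set D := fderiv ℝ ψ 0 with hD
  set A := S.hess l x with hA
  set V : ℂ → ℝ := fun z => s * (S.augmented l (ψ z) - S.augmented l x) with hV
  set G : ℂ → PhaseSpace k := fun z => gradient (S.augmented l) (ψ z) with hG
  have hVd : ∀ z ∈ ball (0 : ℂ) r, HasFDerivAt V
      (s • (innerSL ℝ (G z) ∘L fderiv ℝ ψ z)) z := by
    intro z hz
    have h1 := (hasFDerivAt_of_contDiffOn (S.contDiffOn_augmented l) (h.mem_Ω hz)).comp z
      (h.hasFDerivAt hz)
    exact (h1.sub_const _).const_mul s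
  have hGd : HasFDerivAt G (A ∘L D) 0 := by
    have h1 := S.hasFDerivAt_gradient_augmented l (h.mem_Ω h.zero_mem)
    rw [h.zero] at h1
    exact HasFDerivAt.comp (0 : ℂ) (by rwa [h.zero]) (h.hasFDerivAt h.zero_mem)
  have hG0 : G 0 = 0 := by simp only [hG, h.zero, hl]
  have hψc : ContinuousAt (fderiv ℝ ψ) 0 :=
    (h.contDiffOn.contDiffAt (isOpen_ball.mem_nhds h.zero_mem)).continuousAt_fderiv one_ne_zero
  have hoG : (fun z => G z - A (D z)) =o[𝓝 0] fun z : ℂ => z := by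
    have := hasFDerivAt_iff_isLittleO_nhds_zero.1 hGd
    simpa [hG0] using this
  -- The radial derivative is `⟨A D z, D z⟩ + o(‖z‖²)`, from the first-order expansion of the
  -- gradient and continuity of the derivative of `ψ`. No second derivative of the chart is needed.
  have hbig : ∀ᶠ z in 𝓝 (0 : ℂ), z ≠ 0 → 0 < s * inner ℝ (G z) (fderiv ℝ ψ z z) := by
    have h1 : (fun z => inner ℝ (G z - A (D z)) (fderiv ℝ ψ z z)) =o[𝓝 0]
        fun z : ℂ => ‖z‖ * ‖z‖ := by
      have h2 : (fun z => fderiv ℝ ψ z z) =O[𝓝 0] fun z : ℂ => z := by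
        have h3 : (fderiv ℝ ψ) =O[𝓝 0] fun _ => (1 : ℝ) := hψc.isBigO_one ℝ
        have h4 : (fun z => fderiv ℝ ψ z z) =O[𝓝 0] fun z : ℂ => ‖fderiv ℝ ψ z‖ * ‖z‖ :=
          Asymptotics.IsBigO.of_bound 1 (Eventually.of_forall fun z => by
            simpa using (fderiv ℝ ψ z).le_opNorm z)
        refine h4.trans ?_
        have h16 := h3.norm_left.mul (Asymptotics.isBigO_refl (fun z : ℂ => ‖z‖) (𝓝 0))
        simp only [one_mul] at h16
        exact Asymptotics.isBigO_norm_right.1 h16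
      have h5 : (fun z => inner ℝ (G z - A (D z)) (fderiv ℝ ψ z z)) =O[𝓝 0]
          fun z : ℂ => ‖G z - A (D z)‖ * ‖fderiv ℝ ψ z z‖ :=
        Asymptotics.IsBigO.of_bound 1 (Eventually.of_forall fun z => by
          simpa using abs_real_inner_le_norm (G z - A (D z)) (fderiv ℝ ψ z z))
      exact h5.trans_isLittleO (hoG.norm_norm.mul_isBigO h2.norm_norm)
    have h6 : (fun z => inner ℝ (A (D z)) ((fderiv ℝ ψ z - D) z)) =o[𝓝 0]
        fun z : ℂ => ‖z‖ * ‖z‖ := by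
      have h7 : (fun z => fderiv ℝ ψ z - D) =o[𝓝 0] fun _ => (1 : ℝ) := by
        rw [Asymptotics.isLittleO_one_iff]
        simpa [hD] using hψc.tendsto.sub_const D
      have h8 : (fun z => inner ℝ (A (D z)) ((fderiv ℝ ψ z - D) z)) =O[𝓝 0]
          fun z : ℂ => ‖fderiv ℝ ψ z - D‖ * (‖z‖ * ‖z‖) :=
        Asymptotics.IsBigO.of_bound ‖A ∘L D‖ (Eventually.of_forall fun z => by
          refine (abs_real_inner_le_norm _ _).trans ?_
          have h9 := (A ∘L D).le_opNorm z
          have h10 := (fderiv ℝ ψ z - D).le_opNorm z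
          rw [Real.norm_of_nonneg (by positivity)]
          calc _ ≤ (‖A ∘L D‖ * ‖z‖) * (‖fderiv ℝ ψ z - D‖ * ‖z‖) := by
                gcongr
                exact h9
            _ = _ := by ring)
      refine h8.trans_isLittleO ?_
      simpa using h7.norm_left.mul_isBigO
        (Asymptotics.isBigO_refl (fun z : ℂ => ‖z‖ * ‖z‖) (𝓝 0))
    have h11 := ((h1.add h6).const_mul_left s)
    filter_upwards [Asymptotics.isLittleO_iff.1 h11 (half_pos hm)] with z hz hz0
    have h12 : inner ℝ (G z) (fderiv ℝ ψ z z) = inner ℝ (A (D z)) (D z) +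
        (inner ℝ (G z - A (D z)) (fderiv ℝ ψ z z) +
          inner ℝ (A (D z)) ((fderiv ℝ ψ z - D) z)) := by
      rw [sub_apply, inner_sub_left, inner_sub_right]
      ring
    have h13 := hpos z
    have h14 : 0 < ‖z‖ := norm_pos_iff.2 hz0
    rw [Real.norm_eq_abs, Real.norm_of_nonneg (by positivity)] at hz
    have h15 := (abs_le.1 hz).1
    rw [h12, mul_add]
    nlinarith [mul_pos hm (mul_pos h14 h14)]
  obtain ⟨ρ, hρ, hρb⟩ := Metric.eventually_nhds_iff.1 hbig
  refine ⟨min ρ R, min_le_right _ _, hκ, lt_min hρ hR, ?_, ?_, ?_, ?_, ?_⟩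
  · have h1 := hasFDerivAt_iff_isLittleO_nhds_zero.1 h.hasFDerivAt_reduced
    simp only [zero_add, h.zero, hx, map_zero, sub_zero] at h1
    refine h1.congr' ?_ EventuallyEq.rfl
    filter_upwards [isOpen_ball.mem_nhds (mem_ball_self hR)] with z hz
    rw [hY z hz]
    exact congrArg _ (hB z)
  · intro z hz
    exact (hVd z (ball_subset_ball ((min_le_right _ _).trans hRr) hz)).continuousAt.continuousWithinAt
  · simp only [hV, h.zero, sub_self, mul_zero]
  · intro z hz hz0 a ha
    rw [mem_ball_zero_iff, lt_min_iff] at hz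
    have hseg : ∀ u ∈ Icc a 1, (u : ℂ) * z ∈ ball (0 : ℂ) r ∧ ‖(u : ℂ) * z‖ < ρ := by
      intro u hu
      have hu0 : 0 ≤ u := ha.1.trans hu.1
      have : ‖(u : ℂ) * z‖ ≤ ‖z‖ := by
        rw [norm_mul, Complex.norm_real, Real.norm_of_nonneg hu0]
        nlinarith [norm_nonneg z, hu.2]
      rw [mem_ball_zero_iff]
      exact ⟨by linarith [hz.2], by linarith [hz.1]⟩
    have hd : ∀ u ∈ Icc a 1, HasDerivAt (fun u : ℝ => V (u * z))
        (s * inner ℝ (G (u * z)) (fderiv ℝ ψ (u * z) z)) u := by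
      intro u hu
      have h1 : HasDerivAt (fun u : ℝ => (u : ℂ) * z) z u := by
        simpa using (Complex.ofRealCLM.hasDerivAt (x := u)).mul_const z
      exact (hVd _ (hseg u hu).1).comp_hasDerivAt u h1
    have hmono : StrictMonoOn (fun u : ℝ => V (u * z)) (Icc a 1) := by
      refine strictMonoOn_of_hasDerivWithinAt_pos (convex_Icc a 1)
        (fun u hu => (hd u hu).continuousAt.continuousWithinAt)
        (fun u hu => (hd u (interior_subset hu)).hasDerivWithinAt) fun u hu => ?_
      have huI := interior_subset hu
      rw [interior_Icc] at hu
      have hu0 : 0 < u := ha.1.trans_lt hu.1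
      have hu0' : (u : ℂ) ≠ 0 := by exact_mod_cast hu0.ne'
      have h1 := hρb (y := (u : ℂ) * z) (by simpa using (hseg u huI).2) (mul_ne_zero hu0' hz0)
      have h2 : fderiv ℝ ψ (u * z) (u * z) = u • fderiv ℝ ψ (u * z) z := by
        rw [← map_smul, Complex.real_smul]
      rw [h2, inner_smul_right, mul_left_comm] at h1
      exact pos_of_mul_pos_right h1 hu0.le
    have := hmono ⟨le_rfl, ha.2.le⟩ ⟨ha.2.le, le_rfl⟩ ha.2
    simpa using this
  · intro z hz
    have hzr := ball_subset_ball ((min_le_right ρ R).trans hRr) hz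
    refine ⟨_, hVd z hzr, ?_⟩
    rw [hY z (ball_subset_ball (min_le_right ρ R) hz)]
    simp only [smul_apply, ContinuousLinearMap.comp_apply,
      innerSL_apply_apply, h.fderiv_planeMap_field hzr]
    rw [S.fderiv_augmented_field l (h.mem_Ω hzr), smul_zero]

end IsLeafChart

end HamiltonianRealization

namespace HamiltonianRealization

variable {k : ℕ} {S : HamiltonianRealization k}

namespace IsLeafChart

variable {x p q : PhaseSpace k} {ψ : ℂ → PhaseSpace k} {r : ℝ} {N : Set (PhaseSpace k)}

/-- A center in the chart is Lyapunov stable and surrounded by periodic orbits. -/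
theorem center (h : S.IsLeafChart x p q ψ r N) (hx : S.field x = 0) {κ : ℝ}
    (hκ : 0 < κ) (hB : ∀ z, (planeMap p q ∘L fderiv ℝ S.field x ∘L fderiv ℝ ψ 0) z =
      Complex.I * κ * z) {l : Fin k → ℝ} (hl : gradient (S.augmented l) x = 0) {s m : ℝ}
    (hm : 0 < m) (hpos : ∀ z, m * ‖z‖ ^ 2 ≤
      s * inner ℝ (S.hess l x (fderiv ℝ ψ 0 z)) (fderiv ℝ ψ 0 z)) :
    LyapunovStableOn S.field (S.leaf x) x ∧
    ∃ ε₀ : ℝ, 0 < ε₀ ∧ ∃ (c : ℝ → ℝ → PhaseSpace k) (T : ℝ → ℝ),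
      (∀ ε ∈ Set.Ioc 0 ε₀, IsPeriodicSolutionOn S.field (S.leaf x) (c ε) (T ε)) ∧
      ContinuousOn (Function.uncurry c) (Set.Ioc 0 ε₀ ×ˢ Set.univ) ∧
      (∀ ε ∈ Set.Ioc 0 ε₀, ∀ ε' ∈ Set.Ioc 0 ε₀, ε ≠ ε' →
        Disjoint (Set.range (c ε)) (Set.range (c ε'))) ∧
      (∀ U ∈ 𝓝 x, ∀ᶠ ε in 𝓝[>] (0 : ℝ), Set.range (c ε) ⊆ U) ∧
      Filter.Tendsto T (𝓝[>] (0 : ℝ)) (𝓝 (2 * Real.pi / κ)) ∧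
      {x} ∪ ⋃ ε ∈ Set.Ioo 0 ε₀, Set.range (c ε) =
        connectedComponentIn (S.leaf x \ Set.range (c ε₀)) x := by
  obtain ⟨Y, K, φ, hYK, hφ, hYY⟩ := exists_globalFlow_extension h.r_pos h.contDiffOn_reduced
  obtain ⟨r', hr', hcen⟩ := h.exists_isPlanarCenter hx hκ hB hl hm hpos (half_pos h.r_pos)
    (half_le_self h.r_pos.le) hYY
  have hb2 : ball (0 : ℂ) r' ⊆ ball 0 (r / 2) := ball_subset_ball hr'
  have hbr : ball (0 : ℂ) r' ⊆ ball 0 r := hb2.trans (ball_subset_ball (half_le_self h.r_pos.le))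
  have h0r : (0 : ℂ) ∈ ball (0 : ℂ) r' := mem_ball_self hcen.r_pos
  have hY0 : Y 0 = 0 := by rw [hYY 0 (hb2 h0r), h.zero, hx, map_zero]
  obtain ⟨ε₀, hε₀, T, horb, hdisj, hshrink, hT, htop⟩ := hcen.exists_family hφ hYK
  have hin : ∀ ε ∈ Ioc 0 ε₀, ∀ t, φ t (ε : ℝ) ∈ ball (0 : ℂ) r' := fun ε hε t => by
    rw [mem_ball_zero_iff]
    exact ((horb ε hε).1 t).2
  have hsol : ∀ z t, φ t z ∈ ball (0 : ℂ) r' →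
      HasDerivAt (fun t => ψ (φ t z)) (S.field (ψ (φ t z))) t := by
    intro z t hz
    refine h.hasDerivAt_lift (c := fun t => φ t z) (hbr hz) ?_
    have := hφ.deriv z t
    rwa [hYY _ (hb2 hz)] at this
  have hψ0 : ContinuousAt ψ 0 := (h.hasFDerivAt h.zero_mem).continuousAt
  have hsmall : ∀ U ∈ 𝓝 x, ∃ ρ > 0, ∀ z : ℂ, ‖z‖ < ρ → ψ z ∈ U := by
    intro U hU
    have h1 : ∀ᶠ z in 𝓝 (0 : ℂ), ψ z ∈ U := hψ0.eventually (by rwa [h.zero])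
    obtain ⟨ρ, hρ, hb⟩ := Metric.eventually_nhds_iff.1 h1
    exact ⟨ρ, hρ, fun z hz => hb (by simpa using hz)⟩
  set D : ℝ → Set ℂ := fun ε => {0} ∪ ⋃ ε' ∈ Ioo 0 ε, range fun t => φ t (ε' : ℝ) with hD
  have hDr : ∀ ε ∈ Ioc 0 ε₀, D ε ⊆ ball 0 r' := by
    rintro ε hε z (rfl | hz)
    · exact h0r
    · simp only [mem_iUnion, mem_range, exists_prop] at hz
      obtain ⟨ε', hε', t, rfl⟩ := hz
      exact hin ε' ⟨hε'.1, hε'.2.le.trans hε.2⟩ t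
  have h0D : ∀ ε, (0 : ℂ) ∈ D ε := fun ε => Or.inl rfl
  refine ⟨?_, ε₀, hε₀.1, fun ε t => ψ (φ t (ε : ℝ)), T, ?_, ?_, ?_, ?_, hT, ?_⟩
  · intro U hU hxU
    obtain ⟨ρ, hρ, hρU⟩ := hsmall U (hU.mem_nhds hxU)
    obtain ⟨ε, hε, hερ⟩ : ∃ ε ∈ Ioc 0 ε₀, ∀ ε' ∈ Ioo 0 ε, ∀ t, ‖φ t (ε' : ℝ)‖ < ρ := by
      obtain ⟨ε, hε, hsub⟩ := mem_nhdsGT_iff_exists_Ioo_subset.1 (hshrink ρ hρ)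
      refine ⟨min ε ε₀, ⟨lt_min hε hε₀.1, min_le_right _ _⟩, fun ε' hε' => ?_⟩
      exact hsub ⟨hε'.1, hε'.2.trans_le (min_le_left _ _)⟩
    -- On the leaf this neighbourhood lies in the image of `D ε`, a union of full orbits, each of
    -- which remains in the disc of radius `ρ` and so is mapped into `U`.
    refine ⟨(N ∩ (fun y => planeMap p q (y - x)) ⁻¹' D ε) ∩ U,
      (h.isOpen_of_isOpen (htop ε hε).1).inter hU, ⟨⟨h.mem, ?_⟩, hxU⟩, inter_subset_right, ?_⟩
    · rw [mem_preimage, sub_self, map_zero]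
      exact h0D ε
    · rintro y ⟨⟨hyD, hyU⟩, hyl⟩ t ht
      have hyD' : y ∈ ψ '' D ε := by
        rw [← h.inter_leaf_eq_image ((hDr ε hε).trans hbr)]
        exact ⟨hyD, hyl⟩
      obtain ⟨z, hz, rfl⟩ := hyD'
      have hzt : ∀ t, φ t z ∈ ball (0 : ℂ) r' ∧ ‖φ t z‖ < ρ := by
        intro t
        rcases hz with rfl | hz
        · rw [hφ.equilibrium hYK hY0]
          exact ⟨h0r, by simpa using hρ⟩
        · simp only [mem_iUnion, mem_range, exists_prop] at hz
          obtain ⟨ε', hε', u, rfl⟩ := hz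
          rw [← hφ.add hYK]
          exact ⟨hin ε' ⟨hε'.1, hε'.2.le.trans hε.2⟩ _, hερ ε' hε' _⟩
      refine ⟨ψ (φ t z), hρU _ (hzt t).2, fun u => ψ (φ u z), by simp only [hφ.zero], rfl,
        fun u _ => ⟨h.mem_leaf _ (hbr (hzt u).1), (hsol z u (hzt u).1).hasDerivWithinAt⟩⟩
  · intro ε hε
    obtain ⟨_, hT0, hper, hmin⟩ := horb ε hε
    refine ⟨fun t => h.mem_leaf _ (hbr (hin ε hε t)), fun t => hsol _ t (hin ε hε t), hT0,
      fun t => congrArg ψ (hper t), fun u hu hu' he => ?_⟩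
    have := h.injOn (hbr (hin ε hε u)) (hbr (hin ε hε 0)) he
    rw [hφ.zero] at this
    exact hmin u ⟨hu, hu'⟩ this
  · refine h.contDiffOn.continuousOn.comp ?_ fun a ha => hbr (hin a.1 ha.1 a.2)
    exact ((hφ.continuous hYK).comp (continuous_snd.prodMk
      (Complex.continuous_ofReal.comp continuous_fst))).continuousOn
  · intro ε hε ε' hε' hne
    rw [Set.disjoint_left]
    rintro _ ⟨t, rfl⟩ ⟨t', he⟩
    exact hdisj ε hε ε' hε' hne t t'
      (h.injOn (hbr (hin ε hε t)) (hbr (hin ε' hε' t')) he.symm)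
  · intro U hU
    obtain ⟨ρ, hρ, hρU⟩ := hsmall U hU
    filter_upwards [hshrink ρ hρ] with ε hε
    rintro _ ⟨t, rfl⟩
    exact hρU _ (hε t)
  · have hmem : ε₀ ∈ Ioc 0 ε₀ := ⟨hε₀.1, le_rfl⟩
    obtain ⟨hDo, hDc, hDK⟩ := htop ε₀ hmem
    have himage : {x} ∪ ⋃ ε ∈ Ioo 0 ε₀, (range fun t => ψ (φ t (ε : ℝ))) = ψ '' D ε₀ := by
      simp only [hD, image_union, image_singleton, h.zero, image_iUnion, ← range_comp]
      rfl
    have hDO := h.inter_leaf_eq_image ((hDr ε₀ hmem).trans hbr)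
    set O := N ∩ (fun y => planeMap p q (y - x)) ⁻¹' D ε₀ with hO
    have hOo : IsOpen O := h.isOpen_of_isOpen hDo
    set Γ := range fun t => ψ (φ t (ε₀ : ℝ)) with hΓ
    have hΓimg : Γ = ψ '' range fun t => φ t (ε₀ : ℝ) := by
      rw [← range_comp]
      rfl
    have hKsub : D ε₀ ∪ (range fun t => φ t (ε₀ : ℝ)) ⊆ ball 0 r := by
      refine union_subset ((hDr ε₀ hmem).trans hbr) ?_
      rintro _ ⟨t, rfl⟩
      exact hbr (hin ε₀ hmem t)
    have hKc : IsCompact (ψ '' D ε₀ ∪ Γ) := by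
      rw [hΓimg, ← image_union]
      exact hDK.image_of_continuousOn (h.contDiffOn.continuousOn.mono hKsub)
    have hDΓ : Disjoint (D ε₀) (range fun t => φ t (ε₀ : ℝ)) := by
      rw [Set.disjoint_right]
      rintro _ ⟨t, rfl⟩ (h0 | hz)
      · exact ((horb ε₀ hmem).1 t).1 h0
      · simp only [mem_iUnion, mem_range, exists_prop] at hz
        obtain ⟨ε', hε', u, he⟩ := hz
        exact hdisj ε' ⟨hε'.1, hε'.2.le⟩ ε₀ hmem hε'.2.ne u t he
    have hsub : ψ '' D ε₀ ⊆ S.leaf x \ Γ := by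
      rintro _ ⟨z, hz, rfl⟩
      refine ⟨h.mem_leaf z (hbr (hDr ε₀ hmem hz)), ?_⟩
      rw [hΓimg]
      rintro ⟨w, hw, he⟩
      have := h.injOn (hKsub (Or.inr hw)) (hbr (hDr ε₀ hmem hz)) he
      exact Set.disjoint_left.1 hDΓ hz (this ▸ hw)
    have hxD : x ∈ ψ '' D ε₀ := ⟨0, h0D ε₀, h.zero⟩
    rw [himage]
    refine Subset.antisymm ?_ ?_
    · refine IsPreconnected.subset_connectedComponentIn ?_ hxD hsub
      exact hDc.image _ (h.contDiffOn.continuousOn.mono ((hDr ε₀ hmem).trans hbr))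
    · intro y hy
      have hCsub := connectedComponentIn_subset (S.leaf x \ Γ) x
      by_contra hyD
      have hyK : y ∈ (ψ '' D ε₀ ∪ Γ)ᶜ := by
        rintro (h1 | h1)
        · exact hyD h1
        · exact (hCsub hy).2 h1
      -- The image of `D ε₀` is open in the leaf, and adding `Γ` to it gives a compact set. Once `Γ`
      -- is removed it is therefore clopen, and a connected set containing `x` cannot leave it.
      obtain ⟨u, huC, huO, huK⟩ := isPreconnected_connectedComponentIn (F := S.leaf x \ Γ) (x := x)
        O (ψ '' D ε₀ ∪ Γ)ᶜ hOo hKc.isClosed.isOpen_compl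
        (fun v hv => by
          by_cases hvD : v ∈ ψ '' D ε₀
          · rw [← hDO] at hvD
            exact Or.inl hvD.1
          · exact Or.inr (by
              rintro (h1 | h1)
              · exact hvD h1
              · exact (hCsub hv).2 h1))
        ⟨x, mem_connectedComponentIn (hsub hxD), by
          rw [← hDO] at hxD
          exact hxD.1⟩ ⟨y, hy, hyK⟩
      refine huK (Or.inl ?_)
      rw [← hDO]
      exact ⟨huO, (hCsub huC).1⟩

end IsLeafChart

end HamiltonianRealization

/-! ### The linear normal form at the equilibrium and the proof of the theorem. -/

namespace HamiltonianRealization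

variable {k : ℕ} {S : HamiltonianRealization k}

/-- Orthonormal tangent vectors to the leaf in which the linearization is antidiagonal. -/
theorem IsNondegenerateEquilibrium.exists_adapted_pair {l : Fin k → ℝ} {x : PhaseSpace k}
    (h : S.IsNondegenerateEquilibrium l x) :
    ∃ (e₁ e₂ : PhaseSpace k) (l₁ l₂ : ℝ), S.poisson x e₁ e₂ ≠ 0 ∧
      S.invariant l x = S.poisson x e₁ e₂ ^ 2 * (l₁ * l₂) ∧
      ∀ v, (∀ i, inner ℝ (gradient (S.C i) x) v = 0) →
        S.poisson x e₁ (S.hess l x v) = S.poisson x e₁ e₂ * l₂ * inner ℝ e₂ v ∧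
        S.poisson x e₂ (S.hess l x v) = -(S.poisson x e₁ e₂ * l₁ * inner ℝ e₁ v) ∧
        inner ℝ (S.hess l x v) v = l₁ * inner ℝ e₁ v ^ 2 + l₂ * inner ℝ e₂ v ^ 2 := by
  have hsymm := S.hess_isSymmetric l h.mem
  have hinv : ∀ u, S.hess l x ((S.hess l x).inverse u) = u := by
    intro u
    have h1 := (S.hess l x).coe_toContinuousLinearEquivOfDetNeZero h.det_ne_zero
    set f := (S.hess l x).toContinuousLinearEquivOfDetNeZero h.det_ne_zero
    rw [← h1, ContinuousLinearMap.inverse_equiv]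
    exact f.apply_symm_apply u
  obtain ⟨e₁, e₂, l₁, l₂, h11, h22, h12, hc1, hc2, hl1, hl2, hA12, hexp, hspan, hdet⟩ :=
    _root_.exists_adapted_pair (splitBasis k) h.independent hsymm
      (A' := (S.hess l x).inverse) (fun i => hinv _)
  simp only [ContinuousLinearMap.coe_coe] at hl1 hl2 hA12
  have hA21 : inner ℝ e₂ (S.hess l x e₁) = 0 := by
    have := hsymm e₂ e₁
    rw [ContinuousLinearMap.coe_coe] at this
    rw [← this, real_inner_comm, hA12]
  have hrest : ∀ w, w - inner ℝ e₁ w • e₁ - inner ℝ e₂ w • e₂ ∈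
      Submodule.span ℝ (range fun i => gradient (S.C i) x) := by
    intro w
    have h21 : inner ℝ e₂ e₁ = 0 := by rw [real_inner_comm, h12]
    apply hspan
    · rw [inner_sub_right, inner_sub_right, inner_smul_right, inner_smul_right, h11, h12]
      ring
    · rw [inner_sub_right, inner_sub_right, inner_smul_right, inner_smul_right, h22, h21]
      ring
  -- Modulo Casimir gradients every covector is a combination of `e₁` and `e₂`, so the tensor at `x`
  -- is determined by `S.poisson x e₁ e₂`.
  have hpoisson : ∀ u w, S.poisson x u w =
      inner ℝ e₁ w * S.poisson x u e₁ + inner ℝ e₂ w * S.poisson x u e₂ := by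
    intro u w
    have h1 := S.poisson_span x u (hrest w)
    rw [← poissonLin_apply, map_sub, map_sub, map_smul, map_smul] at h1
    simp only [poissonLin_apply, smul_eq_mul] at h1
    linarith
  refine ⟨e₁, e₂, l₁, l₂, ?_, ?_, fun v hv => ?_⟩
  · refine mul_ne_zero h.ν_ne_zero ?_
    rw [← isUnit_iff_ne_zero, ← Module.Basis.is_basis_iff_det]
    have htop : Submodule.span ℝ
        (range (Sum.elim (fun i => gradient (S.C i) x) ![e₁, e₂])) = ⊤ := by
      rw [eq_top_iff]
      intro w _
      have hle : Submodule.span ℝ (range fun i => gradient (S.C i) x) ≤ Submodule.span ℝ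
          (range (Sum.elim (fun i => gradient (S.C i) x) ![e₁, e₂])) := by
        refine Submodule.span_mono ?_
        rintro _ ⟨i, rfl⟩
        exact ⟨Sum.inl i, rfl⟩
      have h1 : e₁ ∈ Submodule.span ℝ
          (range (Sum.elim (fun i => gradient (S.C i) x) ![e₁, e₂])) :=
        Submodule.subset_span ⟨Sum.inr 0, rfl⟩
      have h2 : e₂ ∈ Submodule.span ℝ
          (range (Sum.elim (fun i => gradient (S.C i) x) ![e₁, e₂])) :=
        Submodule.subset_span ⟨Sum.inr 1, rfl⟩
      have h3 := add_mem (add_mem (hle (hrest w)) (Submodule.smul_mem _ (inner ℝ e₂ w) h2))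
        (Submodule.smul_mem _ (inner ℝ e₁ w) h1)
      simpa using h3
    exact ⟨linearIndependent_of_top_le_span_of_card_eq_finrank htop.ge (by simp), htop⟩
  · have h1 : (S.hess l x).det = LinearMap.det (S.hess l x).toLinearMap := rfl
    rw [invariant, mul_assoc, h1, hdet, poisson]
    ring
  · have hv' := hexp v hv
    have h1 : inner ℝ e₁ (S.hess l x v) = l₁ * inner ℝ e₁ v := by
      conv_lhs => rw [hv']
      rw [map_add, map_smul, map_smul, inner_add_right, inner_smul_right, inner_smul_right, hl1,
        hA12]
      ring
    have h2 : inner ℝ e₂ (S.hess l x v) = l₂ * inner ℝ e₂ v := by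
      conv_lhs => rw [hv']
      rw [map_add, map_smul, map_smul, inner_add_right, inner_smul_right, inner_smul_right, hl2,
        hA21]
      ring
    refine ⟨?_, ?_, ?_⟩
    · rw [hpoisson, h2, poisson_self]
      ring
    · rw [hpoisson, h1, poisson_self, S.poisson_antisymm x e₁ e₂]
      ring
    · refine (congrArg (inner ℝ (S.hess l x v)) hv').trans ?_
      rw [inner_add_right, inner_smul_right, inner_smul_right, real_inner_comm e₁, h1,
        real_inner_comm e₂, h2]
      ring

end HamiltonianRealization

theorem charpoly_antidiagonal {B : ℂ →ₗ[ℝ] ℂ} {a b : ℝ} (hB : ∀ z, B z = ⟨a * z.im, b * z.re⟩) :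
    B.charpoly = Polynomial.X ^ 2 + Polynomial.C (-(a * b)) := by
  have hM : LinearMap.toMatrix Complex.basisOneI Complex.basisOneI B = !![0, a; b, 0] := by
    ext i j
    fin_cases i <;> fin_cases j <;> simp [LinearMap.toMatrix_apply, hB]
  rw [← LinearMap.charpoly_toMatrix B Complex.basisOneI, hM, Matrix.charpoly_fin_two]
  simp [Matrix.trace_fin_two, Matrix.det_fin_two]

theorem theorem6p1 {k : ℕ} (S : HamiltonianRealization k) (l : Fin k → ℝ) (xe : PhaseSpace k)
    (hxe : S.IsNondegenerateEquilibrium l xe) :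
    S.field xe = 0 ∧
    (∃ L : tangentSpaceOf (S.leaf xe) xe →ₗ[ℝ] tangentSpaceOf (S.leaf xe) xe,
      IsLinearizationOn S.field (S.leaf xe) xe L ∧
      L.charpoly = Polynomial.X ^ 2 + Polynomial.C (S.invariant l xe)) ∧
    (S.invariant l xe < 0 → UnstableOn S.field (S.leaf xe) xe) ∧
    (0 < S.invariant l xe → LyapunovStableOn S.field (S.leaf xe) xe) ∧
    (0 < S.invariant l xe →
      ∃ ε₀ : ℝ, 0 < ε₀ ∧ ∃ (c : ℝ → ℝ → PhaseSpace k) (T : ℝ → ℝ),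
        (∀ ε ∈ Set.Ioc 0 ε₀, IsPeriodicSolutionOn S.field (S.leaf xe) (c ε) (T ε)) ∧
        ContinuousOn (Function.uncurry c) (Set.Ioc 0 ε₀ ×ˢ Set.univ) ∧
        (∀ ε ∈ Set.Ioc 0 ε₀, ∀ ε' ∈ Set.Ioc 0 ε₀, ε ≠ ε' →
          Disjoint (Set.range (c ε)) (Set.range (c ε'))) ∧
        (∀ U ∈ 𝓝 xe, ∀ᶠ ε in 𝓝[>] (0 : ℝ), Set.range (c ε) ⊆ U) ∧
        Filter.Tendsto T (𝓝[>] (0 : ℝ)) (𝓝 (2 * Real.pi / Real.sqrt (S.invariant l xe))) ∧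
        {xe} ∪ ⋃ ε ∈ Set.Ioo 0 ε₀, Set.range (c ε) =
          connectedComponentIn (S.leaf xe \ Set.range (c ε₀)) xe) := by
  have hx := hxe.mem
  have hfield := S.field_eq_zero hx hxe.critical
  obtain ⟨e₁, e₂, l₁, l₂, hg, hinv, hv⟩ := hxe.exists_adapted_pair
  set g := S.poisson xe e₁ e₂ with hgdef
  have hlinear : ∀ a b w, S.poisson xe (a • e₁ + b • e₂) w =
      a * S.poisson xe e₁ w + b * S.poisson xe e₂ w := fun a b w => by
    rw [S.poisson_add_left, S.poisson_smul_left, S.poisson_smul_left]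
  have hpq : ∀ a b a' b' : ℝ, S.poisson xe (a • e₁ + b • e₂) (a' • e₁ + b' • e₂) =
      (a * b' - b * a') * g := fun a b a' b' => by
    rw [hlinear, S.poisson_antisymm xe _ e₁, S.poisson_antisymm xe _ e₂, hlinear, hlinear,
      S.poisson_self, S.poisson_self, S.poisson_antisymm xe e₁ e₂]
    ring
  have hB : ∀ {p q ψ r N}, S.IsLeafChart xe p q ψ r N → ∀ z,
      (planeMap p q ∘L fderiv ℝ S.field xe ∘L fderiv ℝ ψ 0) z =
        ⟨S.poisson xe p (S.hess l xe (fderiv ℝ ψ 0 z)),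
          S.poisson xe q (S.hess l xe (fderiv ℝ ψ 0 z))⟩ := fun h z => by
    apply Complex.ext
    · exact S.inner_fderiv_field hx hxe.critical _ _
    · exact S.inner_fderiv_field hx hxe.critical _ _
  refine ⟨hfield, ?_, fun hneg => ?_, imp_and.1 fun hpos => ?_⟩
  · obtain ⟨ψ, r, N, h, -⟩ := S.exists_isLeafChart (p := e₁) (q := e₂) hx hg univ_mem
    obtain ⟨L, hL, hchar⟩ := h.exists_isLinearizationOn hfield
    refine ⟨L, hL, ?_⟩
    have h1 := charpoly_antidiagonal
      (B := (planeMap e₁ e₂ ∘L fderiv ℝ S.field xe ∘L fderiv ℝ ψ 0).toLinearMap)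
      (a := g * l₂) (b := -(g * l₁)) fun z => by
        obtain ⟨h1, h2, -⟩ := hv _ fun i => h.inner_gradient_fderiv_zero z i
        rw [ContinuousLinearMap.coe_coe, hB h, h1, h2, ← planeMap_re e₁ e₂, ← planeMap_im e₁ e₂,
          h.planeMap_fderiv_zero, neg_mul]
    rw [hchar, h1, hinv]
    congr 2
    ring
  · have hμ := Real.sqrt_pos.2 (neg_pos.2 hneg)
    have hμ2 := Real.sq_sqrt (neg_pos.2 hneg).le
    set μ := Real.sqrt (-S.invariant l xe)
    rw [hinv] at hμ2
    have hl2 : l₂ ≠ 0 := by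
      rintro rfl
      rw [hinv] at hneg
      simp at hneg
    -- These functionals are the left eigenvectors of the linearization for `μ` and `-μ`, as `μ² =
    -- -g² l₁ l₂`. They are independent because `l₂ ≠ 0`.
    obtain ⟨ψ, r, N, h, -⟩ := S.exists_isLeafChart (p := μ • e₁ + (g * l₂) • e₂)
      (q := μ • e₁ + (-(g * l₂)) • e₂) hx
      (by
        rw [hpq]
        refine mul_ne_zero ?_ hg
        rw [show μ * -(g * l₂) - g * l₂ * μ = -2 * (μ * (g * l₂)) by ring]
        exact mul_ne_zero (by norm_num) (mul_ne_zero hμ.ne' (mul_ne_zero hg hl2))) univ_mem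
    refine h.unstableOn hfield hμ fun z => ?_
    obtain ⟨h1, h2, -⟩ := hv _ fun i => h.inner_gradient_fderiv_zero z i
    have h3 : z.re = μ * inner ℝ e₁ (fderiv ℝ ψ 0 z) + g * l₂ * inner ℝ e₂ (fderiv ℝ ψ 0 z) := by
      conv_lhs => rw [← h.planeMap_fderiv_zero z]
      simp [inner_add_left, inner_smul_left]
    have h4 : z.im = μ * inner ℝ e₁ (fderiv ℝ ψ 0 z) - g * l₂ * inner ℝ e₂ (fderiv ℝ ψ 0 z) := by
      conv_lhs => rw [← h.planeMap_fderiv_zero z]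
      simp [inner_add_left, inner_smul_left]
      ring
    rw [hB h, hlinear, hlinear, h1, h2, h3, h4]
    congr 1
    · linear_combination (-(inner ℝ e₁ (fderiv ℝ ψ 0 z))) * hμ2
    · linear_combination (inner ℝ e₁ (fderiv ℝ ψ 0 z)) * hμ2
  · have hκ := Real.sqrt_pos.2 hpos
    have hκ2 := Real.sq_sqrt hpos.le
    set κ := Real.sqrt (S.invariant l xe)
    have hl12 : 0 < l₁ * l₂ := by
      rw [hinv] at hpos
      exact pos_of_mul_pos_right hpos (sq_nonneg g)
    have hl2 : l₂ ≠ 0 := right_ne_zero_of_mul hl12.ne'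
    -- Rescaling the two axes turns the antidiagonal matrix into the rotation `iκ`, as `κ² = g² l₁
    -- l₂`.
    obtain ⟨ψ, r, N, h, -⟩ := S.exists_isLeafChart (p := κ • e₁ + (0 : ℝ) • e₂)
      (q := (0 : ℝ) • e₁ + (-(g * l₂)) • e₂) hx
      (by rw [hpq]; simp [hκ.ne', hg, hl2]) univ_mem
    have hcoord : ∀ z, z.re = κ * inner ℝ e₁ (fderiv ℝ ψ 0 z) ∧
        z.im = -(g * l₂) * inner ℝ e₂ (fderiv ℝ ψ 0 z) := fun z => by
      constructor
      · conv_lhs => rw [← h.planeMap_fderiv_zero z]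
        simp [inner_smul_left]
      · conv_lhs => rw [← h.planeMap_fderiv_zero z]
        simp [inner_smul_left]
    -- As `l₁` and `l₂` have the same sign, `s = l₁` makes the Hessian positive on the tangent
    -- plane. In the rescaled coordinates it becomes exactly `m * ‖z‖ ^ 2`, so the required
    -- inequality is an equality.
    refine h.center hfield hκ (fun z => ?_) hxe.critical (s := l₁) (m := l₁ * l₂ / (g * l₂) ^ 2)
      (div_pos hl12 (by positivity)) fun z => ?_
    · obtain ⟨h1, h2, -⟩ := hv _ fun i => h.inner_gradient_fderiv_zero z i
      obtain ⟨h3, h4⟩ := hcoord z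
      rw [hB h, hlinear, hlinear, h1, h2]
      apply Complex.ext
      · simp [h4]
      · simp [h3]
        linear_combination (-(inner ℝ e₁ (fderiv ℝ ψ 0 z))) * (hκ2.trans hinv)
    · obtain ⟨-, -, h1⟩ := hv _ fun i => h.inner_gradient_fderiv_zero z i
      obtain ⟨h3, h4⟩ := hcoord z
      rw [h1, ← Complex.normSq_eq_norm_sq, Complex.normSq_apply, h3, h4,
        div_mul_eq_mul_div, div_le_iff₀ (by positivity)]
      refine le_of_eq ?_
      linear_combination (l₁ * l₂ * (inner ℝ e₁ (fderiv ℝ ψ 0 z)) ^ 2) * (hκ2.trans hinv)
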